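/- Let $p\ge 1$, $q\ge 0$ be integers with $n=p+q\ge 3$, let $r\ge 1$, and put $d=\tfrac n2-r$. Let $\eta_j=1$ for $1\le j\le p$ and $\eta_j=-1$ for $p<j\le n$. On $A_{\mathbb R}=\mathbb R[X_1,\dots,X_n]$ write $\partial_j=\partial/\partial X_j$ and consider $$F=\sum_{j}\eta_jX_j^2,\quad E=\sum_j X_j\partial_j,\quad \square_p=\tfrac12\sum_j\eta_j\partial_j^2,\quad Q_j=F\partial_j-2\eta_jX_j(E+d),\quad D_{jk}=X_j\partial_k-\eta_j\eta_kX_k\partial_j .$$ Let $\mathcal M_{p,r}=\{a\in A_{\mathbb R}:\square_p^{\,r}a=0\}$ be the space of real higher harmonics of level $r$. The operators $E+d$, $\partial_j$, $Q_j$, $D_{jk}$ ($1\le j,k\le n$) preserve $\mathcal M_{p,r}$, and their real span is a Lie algebra isomorphic to $\mathfrak{so}(p+1,q+1)$. This makes $\mathcal M_{p,r}$ an $\mathfrak{so}(p+1,q+1)$-module. Explicitly, give $\mathbb R^{n+2}$ the coordinates $y_+,y_1,\dots,y_n,y_-$ and the quadratic form $y_+^2+\sum_j\eta_jy_j^2-y_-^2$;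 a matrix $A$ that is skew for this form acts by $$A_{+-}(E+d)-\tfrac12\sum_j(A_{j-}+A_{j+})\,\partial_j-\tfrac12\sum_j(A_{j-}-A_{j+})\,Q_j-\tfrac12\sum_{j,k}A_{kj}D_{jk}.$$ Then: 1. if $n$ is odd, or $n$ is even and $r<\tfrac n2$, the $\mathfrak{so}(p+1,q+1)$-module $\mathcal M_{p,r}$ is simple; 2. if $n$ is even and $r\ge\tfrac n2$, the socle $S'$ of $\mathcal M_{p,r}$ (the sum of its simple submodules) is simple and finite-dimensional, and the quotient $\mathcal M_{p,r}/S'$ is simple and infinite-dimensional. -/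

import Mathlib

namespace HigherHarmonics

open MvPolynomial

noncomputable section

attribute [local instance] LieRing.ofAssociativeRing

/-- The variables `X_1, …, X_n`, `n = p + q`: the summand `Fin p` indexes the first `p` of them (on
which the quadratic form is positive), the summand `Fin q` the last `q` (on which it is
negative). -/
abbrev Idx (p q : ℕ) : Type := Fin p ⊕ Fin q

/-- The polynomial ring `ℝ[X_1, …, X_n]`. -/
abbrev Poly (p q : ℕ) : Type := MvPolynomial (Idx p q) ℝ

/-- The sign `η_j` of the `j`-th variable: `1` for the first `p` variables, `-1` for the others. -/
def sgn {p q : ℕ} : Idx p q → ℝ := Sum.elim (fun _ => 1) (fun _ => -1)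

/-- The quadratic form `F = ∑_{j ≤ p} X_j² - ∑_{j > p} X_j²`. -/
def quadForm (p q : ℕ) : Poly p q := ∑ j, C (sgn j) * X j ^ 2

/-- Multiplication by a polynomial, as an operator on polynomials. -/
def mulOp {p q : ℕ} (g : Poly p q) : Module.End ℝ (Poly p q) := LinearMap.mulLeft ℝ g

/-- The partial derivative `∂_j`, as an operator on polynomials. -/
def dOp {p q : ℕ} (j : Idx p q) : Module.End ℝ (Poly p q) := (pderiv j).toLinearMap

/-- The Euler operator `E = ∑_j X_j ∂_j`. -/
def euler (p q : ℕ) : Module.End ℝ (Poly p q) := ∑ j, mulOp (X j) * dOp j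

/-- The d'Alembertian `□_p = ½ (∑_{j ≤ p} ∂_j² - ∑_{j > p} ∂_j²)`. -/
def box (p q : ℕ) : Module.End ℝ (Poly p q) := (1 / 2 : ℝ) • ∑ j, sgn j • dOp j ^ 2

/-- The higher harmonics of level `r`: the polynomials `a` with `□_p ^ r a = 0`. -/
def higherHarmonics (p q r : ℕ) : Submodule ℝ (Poly p q) := LinearMap.ker (box p q ^ r)

/-- The number `d = n / 2 - r`. -/
def wt (p q r : ℕ) : ℝ := ((p : ℝ) + q) / 2 - r

/-- The operator `E + d`. -/
def eulerShift (p q r : ℕ) : Module.End ℝ (Poly p q) := euler p q + wt p q r • 1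

/-- The operator `Q_j = F ∂_j - 2 X_j (E + d)` for `j ≤ p`, and
`Q_j = F ∂_j + 2 X_j (E + d)` for `j > p`. -/
def qOp {p q : ℕ} (r : ℕ) (j : Idx p q) : Module.End ℝ (Poly p q) :=
  mulOp (quadForm p q) * dOp j - (2 * sgn j) • (mulOp (X j) * eulerShift p q r)

/-- The operator `X_j ∂_k - X_k ∂_j` if `j, k ≤ p` or `j, k > p`, and `X_j ∂_k + X_k ∂_j` if
exactly one of `j, k` is `≤ p`. -/
def rotOp {p q : ℕ} (j k : Idx p q) : Module.End ℝ (Poly p q) :=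
  mulOp (X j) * dOp k - (sgn j * sgn k) • (mulOp (X k) * dOp j)

/-- The index set of the standard coordinates `y_a` on `ℝ^{p+1,q+1}`; the first `p + 1` of them are
the positive ones. -/
abbrev BigIdx (p q : ℕ) : Type := Fin (p + 1) ⊕ Fin (q + 1)

/-- The real Lie algebra `𝔰𝔬(p+1,q+1)` of the matrices that are skew with respect to
`diag(1, …, 1, -1, …, -1)`. -/
abbrev SO (p q : ℕ) : LieSubalgebra ℝ (Matrix (BigIdx p q) (BigIdx p q) ℝ) :=
  LieAlgebra.Orthogonal.so' (Fin (p + 1)) (Fin (q + 1)) ℝ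

/-- The additional positive coordinate of `ℝ^{p+1,q+1}`. -/
abbrev plus {p q : ℕ} : BigIdx p q := Sum.inl 0

/-- The additional negative coordinate of `ℝ^{p+1,q+1}`. -/
abbrev minus {p q : ℕ} : BigIdx p q := Sum.inr 0

/-- The inclusion of `ℝ^{p,q}` in `ℝ^{p+1,q+1}`, on coordinates. -/
def up {p q : ℕ} : Idx p q → BigIdx p q := Sum.map Fin.succ Fin.succ

/-- The action of a matrix `A ∈ 𝔰𝔬(p+1,q+1)` by differential operators. It is the linear map from
`𝔰𝔬(p+1,q+1)` onto the span of the operators `E + d`, `∂_j`, `Q_j` and `D_{jk}` (`rotOp j k`) that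
comes from `-(A y) · ∂_y` on functions homogeneous of degree `-d` on the cone
`∑ ± y_a² = 0`, restricted to the section `x ↦ ((1 - F(x)) / 2, x, (1 + F(x)) / 2)`. -/
def confOp (p q r : ℕ) :
    Matrix (BigIdx p q) (BigIdx p q) ℝ →ₗ[ℝ] Module.End ℝ (Poly p q) where
  toFun A := A plus minus • eulerShift p q r
    - (1 / 2 : ℝ) • ∑ j, (A (up j) minus + A (up j) plus) • dOp j
    - (1 / 2 : ℝ) • ∑ j, (A (up j) minus - A (up j) plus) • qOp r j
    - (1 / 2 : ℝ) • ∑ j, ∑ k, A (up k) (up j) • rotOp j k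
  map_add' A B := by
    have h1 : ∀ j, (A + B) (up j) minus + (A + B) (up j) plus
        = (A (up j) minus + A (up j) plus) + (B (up j) minus + B (up j) plus) := fun j => by
      simp only [Matrix.add_apply]; ring
    have h2 : ∀ j, (A + B) (up j) minus - (A + B) (up j) plus
        = (A (up j) minus - A (up j) plus) + (B (up j) minus - B (up j) plus) := fun j => by
      simp only [Matrix.add_apply]; ring
    simp only [h1, h2]
    simp only [Matrix.add_apply, add_smul, Finset.sum_add_distrib, smul_add]
    abel
  map_smul' c A := by
    have h1 : ∀ j, (c • A) (up j) minus + (c • A) (up j) plus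
        = c * (A (up j) minus + A (up j) plus) := fun j => by
      simp only [Matrix.smul_apply, smul_eq_mul]; ring
    have h2 : ∀ j, (c • A) (up j) minus - (c • A) (up j) plus
        = c * (A (up j) minus - A (up j) plus) := fun j => by
      simp only [Matrix.smul_apply, smul_eq_mul]; ring
    simp only [h1, h2]
    simp only [Matrix.smul_apply, smul_eq_mul, mul_smul, ← Finset.smul_sum,
      smul_sub, smul_comm c (1 / 2 : ℝ), RingHom.id_apply]

section Bracket

variable {p q : ℕ}

theorem mulOp_apply (g f : Poly p q) : mulOp g f = g * f := rfl
theorem dOp_apply (j : Idx p q) (f : Poly p q) : dOp j f = pderiv j f := rfl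
theorem euler_apply (f : Poly p q) : euler p q f = ∑ j, X j * pderiv j f := by
  simp [euler, mulOp_apply, dOp_apply, LinearMap.sum_apply]
theorem eulerShift_apply (r : ℕ) (f : Poly p q) :
    eulerShift p q r f = euler p q f + C (wt p q r) * f := by
  simp [eulerShift, MvPolynomial.smul_eq_C_mul]
theorem qOp_apply (r : ℕ) (j : Idx p q) (f : Poly p q) :
    qOp r j f = quadForm p q * pderiv j f
      - 2 * C (sgn j) * (X j * (euler p q f + C (wt p q r) * f)) := by
  have h : (2 : Poly p q) = C 2 := (map_ofNat C 2).symm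
  rw [h, ← C_mul]
  simp only [qOp, mulOp_apply, dOp_apply, eulerShift_apply, LinearMap.sub_apply,
    Module.End.mul_apply, LinearMap.smul_apply, MvPolynomial.smul_eq_C_mul]
theorem rotOp_apply (j k : Idx p q) (f : Poly p q) :
    rotOp j k f = X j * pderiv k f - C (sgn j * sgn k) * (X k * pderiv j f) := by
  simp only [rotOp, mulOp_apply, dOp_apply, LinearMap.sub_apply, Module.End.mul_apply,
    LinearMap.smul_apply, MvPolynomial.smul_eq_C_mul]

/-- The section `x ↦ ((1 - F) / 2, x, (1 + F) / 2)` of the light cone. -/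
def cone : BigIdx p q → Poly p q :=
  Sum.elim (Fin.cons (C (1 / 2) * (1 - quadForm p q)) fun j => X (Sum.inl j))
    (Fin.cons (C (1 / 2) * (1 + quadForm p q)) fun j => X (Sum.inr j))

theorem cone_up (j : Idx p q) : cone (up j) = X j := by
  rcases j with j | j <;> simp [cone, up]

theorem cone_plus : cone (plus : BigIdx p q) = C (1 / 2) * (1 - quadForm p q) := by
  simp [cone]

theorem cone_minus : cone (minus : BigIdx p q) = C (1 / 2) * (1 + quadForm p q) := by
  simp [cone]

theorem sum_big {M : Type*} [AddCommMonoid M] (f : BigIdx p q → M) :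
    ∑ a, f a = f plus + f minus + ∑ j, f (up j) := by
  simp only [Fintype.sum_sum_type, Fin.sum_univ_succ, up, Sum.map_inl, Sum.map_inr]
  abel

/-- The vector `A y` along the section of the light cone. -/
def coneMul (A : Matrix (BigIdx p q) (BigIdx p q) ℝ) : BigIdx p q → Poly p q :=
  (A.map C).mulVec cone

/-- The sum of the two additional coordinates of `A y`. -/
def gfun (A : Matrix (BigIdx p q) (BigIdx p q) ℝ) : Poly p q := coneMul A plus + coneMul A minus

theorem coneMul_apply (A : Matrix (BigIdx p q) (BigIdx p q) ℝ) (a : BigIdx p q) :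
    coneMul A a = ∑ b, C (A a b) * cone b := rfl

/-- The signs of the coordinates of `ℝ^{p+1,q+1}`. -/
def bsgn : BigIdx p q → ℝ := Sum.elim (fun _ => 1) (fun _ => -1)

theorem bsgn_up (j : Idx p q) : bsgn (up j) = sgn j := by
  rcases j with j | j <;> simp [bsgn, up, sgn]

theorem bsgn_plus : bsgn (plus : BigIdx p q) = 1 := rfl
theorem bsgn_minus : bsgn (minus : BigIdx p q) = -1 := rfl

theorem sgn_mul_self (j : Idx p q) : sgn j * sgn j = 1 := by
  rcases j with j | j <;> simp [sgn]

theorem skew {A : Matrix (BigIdx p q) (BigIdx p q) ℝ} (hA : A ∈ SO p q) (a b : BigIdx p q) :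
    bsgn a * A a b = -(bsgn b * A b a) := by
  have h : A.transpose * LieAlgebra.Orthogonal.indefiniteDiagonal (Fin (p + 1)) (Fin (q + 1)) ℝ
      = LieAlgebra.Orthogonal.indefiniteDiagonal (Fin (p + 1)) (Fin (q + 1)) ℝ * (-A) := by
    exact (mem_skewAdjointMatricesSubmodule _ A).1 hA
  have h1 := congrFun (congrFun h b) a
  simp only [LieAlgebra.Orthogonal.indefiniteDiagonal, Matrix.mul_diagonal, Matrix.diagonal_mul,
    Matrix.transpose_apply, Matrix.neg_apply] at h1
  change A a b * bsgn a = bsgn b * -(A b a) at h1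
  linarith

theorem sum_cone {A : Matrix (BigIdx p q) (BigIdx p q) ℝ} (hA : A ∈ SO p q) :
    ∑ a, C (bsgn a) * cone a * coneMul A a = 0 := by
  have h : ∑ a, C (bsgn a) * cone a * coneMul A a
      = -∑ a, C (bsgn a) * cone a * coneMul A a := by
    simp only [coneMul_apply, Finset.mul_sum]
    conv_rhs => rw [Finset.sum_comm]
    rw [← Finset.sum_neg_distrib]
    refine Finset.sum_congr rfl fun a _ => ?_
    rw [← Finset.sum_neg_distrib]
    refine Finset.sum_congr rfl fun b _ => ?_
    have := congrArg (C : ℝ → Poly p q) (skew hA a b)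
    rw [C_mul, C_neg, C_mul] at this
    linear_combination (cone a * cone b) * this
  exact self_eq_neg.1 h

/-- The first-order part of the operator attached to `A`. -/
def field (A : Matrix (BigIdx p q) (BigIdx p q) ℝ) : Derivation ℝ (Poly p q) (Poly p q) :=
  mkDerivation ℝ fun j => X j * gfun A - coneMul A (up j)

theorem field_X (A : Matrix (BigIdx p q) (BigIdx p q) ℝ) (j : Idx p q) :
    field A (X j) = X j * gfun A - coneMul A (up j) := mkDerivation_X _ _ _

theorem half : (C (1 / 2) : Poly p q) * 2 = 1 := by
  have : (2 : Poly p q) = C 2 := (map_ofNat C 2).symm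
  rw [this, ← C_mul]
  norm_num

theorem field_C (A : Matrix (BigIdx p q) (BigIdx p q) ℝ) (c : ℝ) :
    field A (C c) = 0 := derivation_C _ _

theorem field_C_mul (A : Matrix (BigIdx p q) (BigIdx p q) ℝ) (c : ℝ) (f : Poly p q) :
    field A (C c * f) = C c * field A f := by
  simp [Derivation.leibniz]

theorem field_quadForm {A : Matrix (BigIdx p q) (BigIdx p q) ℝ} (hA : A ∈ SO p q) :
    field A (quadForm p q) = 2 * quadForm p q * gfun A
      + 2 * (cone plus * coneMul A plus - cone minus * coneMul A minus) := by
  have h := sum_cone hA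
  rw [sum_big, bsgn_plus, bsgn_minus, C_neg, C_1] at h
  simp only [bsgn_up, cone_up] at h
  have h2 : field A (quadForm p q) = 2 * quadForm p q * gfun A
      - 2 * ∑ j, C (sgn j) * X j * coneMul A (up j) := by
    simp only [quadForm, map_sum, field_C_mul, Finset.mul_sum, Finset.sum_mul,
      ← Finset.sum_sub_distrib]
    refine Finset.sum_congr rfl fun j _ => ?_
    rw [Derivation.leibniz_pow, field_X]
    simp only [nsmul_eq_mul, smul_eq_mul]
    push_cast
    ring
  linear_combination h2 - 2 * h

theorem big_cases {P : BigIdx p q → Prop} (h1 : P plus) (h2 : P minus) (h3 : ∀ j, P (up j))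
    (a : BigIdx p q) : P a := by
  rcases a with a | a <;> induction a using Fin.cases with
  | zero => assumption
  | succ j => first | exact h3 (Sum.inl j) | exact h3 (Sum.inr j)

theorem field_cone {A : Matrix (BigIdx p q) (BigIdx p q) ℝ} (hA : A ∈ SO p q) (a : BigIdx p q) :
    field A (cone a) = gfun A * cone a - coneMul A a := by
  have hF := field_quadForm hA
  have h2 := half (p := p) (q := q)
  rw [cone_plus, cone_minus] at hF
  revert a
  refine big_cases ?_ ?_ fun j => ?_
  · rw [cone_plus, field_C_mul, map_sub, hF, Derivation.map_one_eq_zero]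
    unfold gfun
    linear_combination (-quadForm p q * (coneMul A plus + coneMul A minus)
      - C (1 / 2) * ((1 - quadForm p q) * coneMul A plus - (1 + quadForm p q) * coneMul A minus)
      - coneMul A plus * (1 - quadForm p q) + coneMul A minus * quadForm p q) * h2
  · rw [cone_minus, field_C_mul, map_add, hF, Derivation.map_one_eq_zero]
    unfold gfun
    linear_combination (quadForm p q * (coneMul A plus + coneMul A minus)
      + C (1 / 2) * ((1 - quadForm p q) * coneMul A plus - (1 + quadForm p q) * coneMul A minus)
      - coneMul A plus * quadForm p q - coneMul A minus * (1 + quadForm p q)) * h2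
  · rw [cone_up, field_X, mul_comm]

theorem gfun_eq {A : Matrix (BigIdx p q) (BigIdx p q) ℝ} (hA : A ∈ SO p q) :
    gfun A = C (A plus minus) +
      ∑ j, C (sgn j * (A (up j) minus - A (up j) plus)) * X j := by
  have e1 : A plus plus = 0 := by
    have := skew hA plus plus
    rw [bsgn_plus] at this
    linarith
  have e2 : A minus minus = 0 := by
    have := skew hA minus minus
    rw [bsgn_minus] at this
    linarith
  have e3 : A minus plus = A plus minus := by
    have := skew hA minus plus
    rw [bsgn_plus, bsgn_minus] at this
    linarith
  have e4 : ∀ j, C (sgn j * (A (up j) minus - A (up j) plus))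
      = (C (A plus (up j)) + C (A minus (up j)) : Poly p q) := fun j => by
    rw [← C_add]
    congr 1
    have h1 := skew hA (up j) plus
    have h2 := skew hA (up j) minus
    rw [bsgn_up, bsgn_plus] at h1
    rw [bsgn_up, bsgn_minus] at h2
    linarith
  have e5 : cone (plus : BigIdx p q) + cone minus = 1 := by
    rw [cone_plus, cone_minus]
    linear_combination half (p := p) (q := q)
  simp only [gfun, coneMul_apply, sum_big, e1, e2, e3, e4, cone_up, C_0, add_mul,
    Finset.sum_add_distrib]
  linear_combination C (A plus minus) * e5

theorem derivation_sum_apply {ι : Type*} (s : Finset ι)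
    (D : ι → Derivation ℝ (Poly p q) (Poly p q)) (f : Poly p q) :
    (∑ j ∈ s, D j) f = ∑ j ∈ s, D j f := by
  have := congrFun (map_sum (Derivation.coeFnAddMonoidHom (R := ℝ) (A := Poly p q)
    (M := Poly p q)) D s) f
  rw [Finset.sum_apply] at this
  exact this

theorem field_apply (A : Matrix (BigIdx p q) (BigIdx p q) ℝ) (f : Poly p q) :
    field A f = ∑ j, (X j * gfun A - coneMul A (up j)) * pderiv j f := by
  have : field A = ∑ j, (X j * gfun A - coneMul A (up j)) • (pderiv j : Derivation ℝ _ (Poly p q)) := by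
    refine derivation_ext fun i => ?_
    rw [field_X, derivation_sum_apply, Finset.sum_eq_single i]
    · simp
    · intro j _ hj
      simp [pderiv_X_of_ne hj.symm]
    · simp
  rw [this, derivation_sum_apply]
  rfl

theorem rot_sum {A : Matrix (BigIdx p q) (BigIdx p q) ℝ} (hA : A ∈ SO p q) (f : Poly p q) :
    ∑ j, ∑ k, C (A (up k) (up j)) * rotOp j k f
      = 2 * ∑ k, ∑ j, C (A (up k) (up j)) * X j * pderiv k f := by
  have h : ∀ j k : Idx p q, C (A (up k) (up j)) * rotOp j k f
      = C (A (up k) (up j)) * X j * pderiv k f + C (A (up j) (up k)) * X k * pderiv j f := by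
    intro j k
    have h1 : A (up k) (up j) * (sgn j * sgn k) = -A (up j) (up k) := by
      have h1 := skew hA (up k) (up j)
      rw [bsgn_up, bsgn_up] at h1
      linear_combination sgn j * h1 - A (up j) (up k) * sgn_mul_self j
    have h2 := congrArg (C : ℝ → Poly p q) h1
    rw [C_mul, C_neg] at h2
    rw [rotOp_apply]
    linear_combination (-X k * pderiv j f) * h2
  simp only [h, Finset.sum_add_distrib]
  rw [Finset.sum_comm]
  ring

theorem confOp_eq (r : ℕ) {A : Matrix (BigIdx p q) (BigIdx p q) ℝ} (hA : A ∈ SO p q)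
    (f : Poly p q) : confOp p q r A f = field A f + C (wt p q r) * gfun A * f := by
  have h0 : confOp p q r A f = C (A plus minus) * (euler p q f + C (wt p q r) * f)
      - C (1 / 2) * ∑ j, C (A (up j) minus + A (up j) plus) * pderiv j f
      - C (1 / 2) * ∑ j, C (A (up j) minus - A (up j) plus) * qOp r j f
      - C (1 / 2) * ∑ j, ∑ k, C (A (up k) (up j)) * rotOp j k f := by
    simp only [confOp, LinearMap.coe_mk, AddHom.coe_mk, LinearMap.sub_apply, LinearMap.smul_apply,
      LinearMap.sum_apply, MvPolynomial.smul_eq_C_mul, eulerShift_apply, dOp_apply]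
  have h1 : field A f + C (wt p q r) * gfun A * f
      = gfun A * (euler p q f + C (wt p q r) * f) - ∑ j, coneMul A (up j) * pderiv j f := by
    rw [field_apply, euler_apply, mul_add, Finset.mul_sum, ← sub_eq_zero]
    simp only [sub_mul, Finset.sum_sub_distrib]
    rw [Finset.sum_congr rfl fun j _ => (by ring :
      X j * gfun A * pderiv j f = gfun A * (X j * pderiv j f))]
    ring
  have h2 : ∑ j, coneMul A (up j) * pderiv j f
      = C (1 / 2) * ∑ j, C (A (up j) minus + A (up j) plus) * pderiv j f
      + C (1 / 2) * ∑ j, C (A (up j) minus - A (up j) plus) * (quadForm p q * pderiv j f)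
      + ∑ k, ∑ j, C (A (up k) (up j)) * X j * pderiv k f := by
    simp only [Finset.mul_sum, ← Finset.sum_add_distrib]
    refine Finset.sum_congr rfl fun j _ => ?_
    rw [coneMul_apply, sum_big, add_mul, Finset.sum_mul, cone_plus, cone_minus]
    simp only [cone_up, C_add, C_sub]
    ring
  have h3 : ∑ j, C (A (up j) minus - A (up j) plus) * qOp r j f
      = ∑ j, C (A (up j) minus - A (up j) plus) * (quadForm p q * pderiv j f)
      - 2 * ((∑ j, C (sgn j * (A (up j) minus - A (up j) plus)) * X j)
          * (euler p q f + C (wt p q r) * f)) := by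
    rw [Finset.sum_mul, Finset.mul_sum, ← Finset.sum_sub_distrib]
    refine Finset.sum_congr rfl fun j _ => ?_
    rw [qOp_apply, C_mul]
    ring
  rw [h0, h1, h2, h3, rot_sum hA, gfun_eq hA]
  linear_combination ((∑ j, C (sgn j * (A (up j) minus - A (up j) plus)) * X j)
          * (euler p q f + C (wt p q r) * f)
      - ∑ k, ∑ j, C (A (up k) (up j)) * X j * pderiv k f) * half (p := p) (q := q)

theorem coneMul_lie (A B : Matrix (BigIdx p q) (BigIdx p q) ℝ) :
    coneMul ⁅A, B⁆ = (A.map C).mulVec (coneMul B) - (B.map C).mulVec (coneMul A) := by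
  have h : (⁅A, B⁆.map C : Matrix _ _ (Poly p q)) = A.map C * B.map C - B.map C * A.map C := by
    rw [Ring.lie_def, Matrix.map_sub _ (fun _ _ => C_sub _ _ _), Matrix.map_mul, Matrix.map_mul]
  rw [coneMul, h, Matrix.sub_mulVec, ← Matrix.mulVec_mulVec, ← Matrix.mulVec_mulVec]
  rfl

theorem field_coneMul {A : Matrix (BigIdx p q) (BigIdx p q) ℝ} (hA : A ∈ SO p q)
    (B : Matrix (BigIdx p q) (BigIdx p q) ℝ) (a : BigIdx p q) :
    field A (coneMul B a) = gfun A * coneMul B a - (B.map C).mulVec (coneMul A) a := by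
  rw [coneMul_apply, map_sum, Finset.mul_sum]
  simp only [field_C_mul, field_cone hA, Matrix.mulVec, dotProduct, Matrix.map_apply]
  rw [← Finset.sum_sub_distrib]
  exact Finset.sum_congr rfl fun b _ => by ring

theorem gfun_lie {A B : Matrix (BigIdx p q) (BigIdx p q) ℝ} (hA : A ∈ SO p q) (hB : B ∈ SO p q) :
    gfun ⁅A, B⁆ = field A (gfun B) - field B (gfun A) := by
  simp only [gfun, coneMul_lie, map_add, field_coneMul hA, field_coneMul hB, Pi.sub_apply]
  ring

theorem field_lie {A B : Matrix (BigIdx p q) (BigIdx p q) ℝ} (hA : A ∈ SO p q) (hB : B ∈ SO p q) :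
    field ⁅A, B⁆ = ⁅field A, field B⁆ := by
  refine derivation_ext fun j => ?_
  rw [Derivation.commutator_apply, field_X, gfun_lie hA hB, coneMul_lie, field_X, field_X]
  simp only [map_sub, Derivation.leibniz, smul_eq_mul, field_coneMul hA, field_coneMul hB, field_X,
    Pi.sub_apply]
  ring

theorem confOp_lie (r : ℕ) {A B : Matrix (BigIdx p q) (BigIdx p q) ℝ}
    (hA : A ∈ SO p q) (hB : B ∈ SO p q) :
    confOp p q r ⁅A, B⁆ = ⁅confOp p q r A, confOp p q r B⁆ := by
  refine LinearMap.ext fun f => ?_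
  rw [Ring.lie_def (confOp p q r A), LinearMap.sub_apply, Module.End.mul_apply, Module.End.mul_apply,
    confOp_eq r hA, confOp_eq r hB, confOp_eq r hB, confOp_eq r hA,
    confOp_eq r ((SO p q).lie_mem hA hB), field_lie hA hB, gfun_lie hA hB,
    Derivation.commutator_apply]
  simp only [map_add, Derivation.leibniz, smul_eq_mul, field_C]
  ring

end Bracket

section Invariance

variable {p q : ℕ}

theorem pderiv_comm (i j : Idx p q) (f : Poly p q) :
    pderiv i (pderiv j f) = pderiv j (pderiv i f) := by
  have h : ⁅(pderiv i : Derivation ℝ (Poly p q) (Poly p q)),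
      (pderiv j : Derivation ℝ (Poly p q) (Poly p q))⁆ = 0 := by
    refine derivation_ext fun k => ?_
    have h0 : ∀ a b : Idx p q, pderiv a (pderiv b (X k : Poly p q)) = 0 := by
      intro a b
      rw [pderiv_X, Pi.single_apply]
      split_ifs <;> simp
    rw [Derivation.commutator_apply, h0, h0, sub_zero, Derivation.zero_apply]
  have h1 := congrArg (fun D : Derivation ℝ (Poly p q) (Poly p q) => D f) h
  simp only [Derivation.commutator_apply, Derivation.zero_apply] at h1
  exact sub_eq_zero.1 h1

theorem box_apply (f : Poly p q) :
    box p q f = C (1 / 2) * ∑ j, C (sgn j) * pderiv j (pderiv j f) := by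
  simp only [box, LinearMap.smul_apply, LinearMap.sum_apply, MvPolynomial.smul_eq_C_mul, pow_two,
    Module.End.mul_apply, dOp_apply]

theorem box_pderiv (i : Idx p q) (f : Poly p q) :
    box p q (pderiv i f) = pderiv i (box p q f) := by
  rw [box_apply, box_apply, pderiv_C_mul, map_sum]
  congr 1
  refine Finset.sum_congr rfl fun j _ => ?_
  rw [pderiv_C_mul, pderiv_comm j i f, pderiv_comm j i]

theorem box_C_mul (c : ℝ) (f : Poly p q) : box p q (C c * f) = C c * box p q f := by
  rw [← MvPolynomial.smul_eq_C_mul, map_smul, MvPolynomial.smul_eq_C_mul]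

theorem box_X_mul (i : Idx p q) (f : Poly p q) :
    box p q (X i * f) = X i * box p q f + C (sgn i) * pderiv i f := by
  have h : ∀ j, pderiv j (pderiv j (X i * f))
      = X i * pderiv j (pderiv j f) + 2 * (pderiv j (X i) * pderiv j f) := by
    intro j
    have h0 : pderiv j (pderiv j (X i : Poly p q)) = 0 := by
      rw [pderiv_X]
      by_cases h1 : i = j <;> simp [h1]
    rw [pderiv_mul, map_add, pderiv_mul, pderiv_mul, h0]
    ring
  have h2 : ∑ j, C (sgn j) * (pderiv j (X i) * pderiv j f) = C (sgn i) * pderiv i f := by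
    rw [Finset.sum_eq_single i]
    · rw [pderiv_X_self, one_mul]
    · intro j _ hj
      rw [pderiv_X_of_ne hj.symm]
      ring
    · simp
  have h3 : ∑ j, C (sgn j) * pderiv j (pderiv j (X i * f))
      = X i * ∑ j, C (sgn j) * pderiv j (pderiv j f) + 2 * (C (sgn i) * pderiv i f) := by
    rw [← h2, Finset.mul_sum, Finset.mul_sum, ← Finset.sum_add_distrib]
    refine Finset.sum_congr rfl fun j _ => ?_
    rw [h]
    ring
  rw [box_apply, box_apply, h3]
  linear_combination (C (sgn i) * pderiv i f) * half (p := p) (q := q)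

theorem two_box (f : Poly p q) :
    ∑ j, C (sgn j) * pderiv j (pderiv j f) = 2 * box p q f := by
  rw [box_apply]
  linear_combination (-∑ j, C (sgn j) * pderiv j (pderiv j f)) * half (p := p) (q := q)

theorem box_euler (f : Poly p q) :
    box p q (euler p q f) = euler p q (box p q f) + 2 * box p q f := by
  rw [euler_apply, euler_apply, ← two_box, map_sum, ← Finset.sum_add_distrib]
  refine Finset.sum_congr rfl fun j _ => ?_
  rw [box_X_mul, box_pderiv]

theorem box_quadForm_mul (f : Poly p q) :
    box p q (quadForm p q * f)
      = quadForm p q * box p q f + 2 * euler p q f + C ((p : ℝ) + q) * f := by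
  have h : ∀ j : Idx p q, box p q (C (sgn j) * X j ^ 2 * f)
      = C (sgn j) * X j ^ 2 * box p q f + (2 * (X j * pderiv j f) + f) := by
    intro j
    have e := congrArg (C : ℝ → Poly p q) (sgn_mul_self j)
    rw [C_mul, C_1] at e
    rw [show C (sgn j) * X j ^ 2 * f = C (sgn j) * (X j * (X j * f)) by ring, box_C_mul,
      box_X_mul, box_X_mul, pderiv_mul, pderiv_X_self]
    linear_combination (2 * (X j * pderiv j f) + f) * e
  have hc : (∑ _j : Idx p q, f) = C ((p : ℝ) + q) * f := by
    simp [Fintype.card_sum]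
  rw [quadForm, Finset.sum_mul, map_sum, Finset.sum_congr rfl fun j _ => h j,
    Finset.sum_add_distrib, Finset.sum_add_distrib, hc, ← Finset.mul_sum, ← euler_apply,
    ← Finset.sum_mul]
  ring

/-- The polynomial `F ∂_j f - 2 η_j X_j (E f + c f)`. -/
def qFun (c : ℝ) (j : Idx p q) (f : Poly p q) : Poly p q :=
  quadForm p q * pderiv j f - 2 * C (sgn j) * (X j * (euler p q f + C c * f))

theorem pderiv_euler (j : Idx p q) (f : Poly p q) :
    pderiv j (euler p q f) = euler p q (pderiv j f) + pderiv j f := by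
  have h : ∑ i, pderiv j (X i) * pderiv i f = pderiv j f := by
    rw [Finset.sum_eq_single j]
    · rw [pderiv_X_self, one_mul]
    · intro i _ hi
      rw [pderiv_X_of_ne hi, zero_mul]
    · simp
  have h2 : pderiv j (∑ i, X i * pderiv i f)
      = ∑ i, X i * pderiv i (pderiv j f) + ∑ i, pderiv j (X i) * pderiv i f := by
    rw [map_sum, ← Finset.sum_add_distrib]
    refine Finset.sum_congr rfl fun i _ => ?_
    rw [pderiv_mul, pderiv_comm j i]
    ring
  rw [euler_apply, euler_apply, h2, h]

theorem box_qFun (c : ℝ) (j : Idx p q) (f : Poly p q) :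
    box p q (qFun c j f)
      = qFun (c + 2) j (box p q f) + C ((p : ℝ) + q - 2 - 2 * c) * pderiv j f := by
  have e := congrArg (C : ℝ → Poly p q) (sgn_mul_self j)
  rw [C_mul, C_1] at e
  have h2 : (2 : Poly p q) = C 2 := (map_ofNat C 2).symm
  have h3 : box p q (2 * C (sgn j) * (X j * (euler p q f + C c * f)))
      = 2 * C (sgn j) * box p q (X j * (euler p q f + C c * f)) := by
    rw [h2, ← C_mul, box_C_mul]
  rw [qFun, qFun, map_sub, h3, box_quadForm_mul, box_pderiv, box_X_mul, map_add (box p q),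
    map_add (pderiv j), box_euler, box_C_mul, pderiv_euler, pderiv_C_mul]
  simp only [C_add, C_sub, C_mul, ← h2]
  linear_combination (-2 * (euler p q (pderiv j f) + pderiv j f + C c * pderiv j f)) * e

theorem box_pow_qFun (c : ℝ) (j : Idx p q) (f : Poly p q) (k : ℕ) :
    (box p q ^ (k + 1)) (qFun c j f)
      = qFun (c + 2 * (k + 1)) j ((box p q ^ (k + 1)) f)
        + C ((k + 1) * ((p : ℝ) + q - 2 * (k + 1) - 2 * c)) * pderiv j ((box p q ^ k) f) := by
  induction k with
  | zero =>
    simp only [zero_add, pow_one, pow_zero, Module.End.one_apply, box_qFun]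
    norm_num
  | succ k ih =>
    rw [pow_succ', Module.End.mul_apply, ih, map_add, box_qFun, box_C_mul, box_pderiv,
      ← Module.End.mul_apply, ← pow_succ', ← Module.End.mul_apply, ← pow_succ', add_assoc,
      ← add_mul, ← C_add]
    rw [show c + 2 * (((k + 1 : ℕ) : ℝ) + 1) = c + 2 * ((k : ℝ) + 1) + 2 by push_cast; ring]
    congr 3
    push_cast
    ring

theorem mem_higherHarmonics (r : ℕ) (f : Poly p q) :
    f ∈ higherHarmonics p q r ↔ (box p q ^ r) f = 0 := LinearMap.mem_ker

theorem pderiv_mem {r : ℕ} (j : Idx p q) {f : Poly p q} (hf : f ∈ higherHarmonics p q r) :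
    pderiv j f ∈ higherHarmonics p q r := by
  have h : ∀ k : ℕ, (box p q ^ k) (pderiv j f) = pderiv j ((box p q ^ k) f) := by
    intro k
    induction k with
    | zero => rfl
    | succ k ih => rw [pow_succ', Module.End.mul_apply, ih, box_pderiv]; rfl
  rw [mem_higherHarmonics] at hf ⊢
  rw [h, hf, map_zero]

theorem euler_mem {r : ℕ} {f : Poly p q} (hf : f ∈ higherHarmonics p q r) :
    euler p q f ∈ higherHarmonics p q r := by
  have h : ∀ k : ℕ, (box p q ^ k) (euler p q f)
      = euler p q ((box p q ^ k) f) + C (2 * k : ℝ) * (box p q ^ k) f := by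
    intro k
    induction k with
    | zero => simp
    | succ k ih =>
      have h2 : (2 : Poly p q) = C 2 := (map_ofNat C 2).symm
      rw [pow_succ', Module.End.mul_apply, ih, map_add, box_euler, box_C_mul, Module.End.mul_apply,
        add_assoc, h2, ← add_mul, ← C_add]
      congr 3
      push_cast
      ring
  rw [mem_higherHarmonics] at hf ⊢
  rw [h, hf, map_zero, mul_zero, add_zero]

theorem rotOp_mem {r : ℕ} (j k : Idx p q) {f : Poly p q} (hf : f ∈ higherHarmonics p q r) :
    rotOp j k f ∈ higherHarmonics p q r := by
  have h1 : ∀ f : Poly p q, box p q (rotOp j k f) = rotOp j k (box p q f) := by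
    intro f
    have e : (C (sgn k) * C (sgn k) : Poly p q) = 1 := by
      rw [← C_mul, sgn_mul_self, C_1]
    rw [rotOp_apply, rotOp_apply, map_sub, box_C_mul, box_X_mul, box_X_mul, box_pderiv, box_pderiv,
      C_mul, pderiv_comm k j]
    linear_combination (-C (sgn j) * pderiv j (pderiv k f)) * e
  have h : ∀ m : ℕ, (box p q ^ m) (rotOp j k f) = rotOp j k ((box p q ^ m) f) := by
    intro m
    induction m with
    | zero => rfl
    | succ m ih => rw [pow_succ', Module.End.mul_apply, ih, h1]; rfl
  rw [mem_higherHarmonics] at hf ⊢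
  rw [h, hf, map_zero]

theorem qOp_mem {r : ℕ} (j : Idx p q) {f : Poly p q} (hf : f ∈ higherHarmonics p q r) :
    qOp r j f ∈ higherHarmonics p q r := by
  rw [mem_higherHarmonics] at hf ⊢
  rcases r with _ | k
  · rw [show f = 0 from hf, map_zero, map_zero]
  · have h := box_pow_qFun (wt p q (k + 1)) j f k
    have h0 : ((k : ℝ) + 1) * ((p : ℝ) + q - 2 * (k + 1) - 2 * wt p q (k + 1)) = 0 := by
      rw [wt]
      push_cast
      ring
    rw [hf, h0, C_0, zero_mul, add_zero] at h
    rw [qOp_apply]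
    exact h.trans (by simp [qFun])

/-- The operators preserve the space of higher harmonics of level `r`. -/
theorem confOp_mem {r : ℕ} (A : Matrix (BigIdx p q) (BigIdx p q) ℝ) {f : Poly p q}
    (hf : f ∈ higherHarmonics p q r) : confOp p q r A f ∈ higherHarmonics p q r := by
  have hE : eulerShift p q r f ∈ higherHarmonics p q r := by
    rw [eulerShift_apply, ← MvPolynomial.smul_eq_C_mul]
    exact add_mem (euler_mem hf) (Submodule.smul_mem _ _ hf)
  simp only [confOp, LinearMap.coe_mk, AddHom.coe_mk, LinearMap.sub_apply, LinearMap.smul_apply,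
    LinearMap.sum_apply]
  refine sub_mem (sub_mem (sub_mem (Submodule.smul_mem _ _ hE) ?_) ?_) ?_
  · exact Submodule.smul_mem _ _ (sum_mem fun j _ => Submodule.smul_mem _ _ (pderiv_mem j hf))
  · exact Submodule.smul_mem _ _ (sum_mem fun j _ => Submodule.smul_mem _ _ (qOp_mem j hf))
  · exact Submodule.smul_mem _ _ (sum_mem fun j _ => sum_mem fun k _ =>
      Submodule.smul_mem _ _ (rotOp_mem j k hf))

end Invariance

theorem confOp_lie_apply (p q r : ℕ) (A B : SO p q) (f : Poly p q) :
    confOp p q r ((⁅A, B⁆ : SO p q) : Matrix (BigIdx p q) (BigIdx p q) ℝ) f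
      = confOp p q r A (confOp p q r B f) - confOp p q r B (confOp p q r A f) := by
  rw [LieSubalgebra.coe_bracket, confOp_lie r A.2 B.2]
  rfl

/-- The representation of `𝔰𝔬(p+1,q+1)` on the higher harmonics of level `r`. -/
def rep (p q r : ℕ) : SO p q →ₗ⁅ℝ⁆ Module.End ℝ (higherHarmonics p q r) where
  toFun A := (confOp p q r (A : Matrix (BigIdx p q) (BigIdx p q) ℝ)).restrict
    fun _ hf => confOp_mem _ hf
  map_add' A B := LinearMap.ext fun f => Subtype.ext <|
    congrArg (fun T : Module.End ℝ (Poly p q) => T f)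
      (map_add (confOp p q r) (A : Matrix (BigIdx p q) (BigIdx p q) ℝ) B)
  map_smul' c A := LinearMap.ext fun f => Subtype.ext <|
    congrArg (fun T : Module.End ℝ (Poly p q) => T f)
      (map_smul (confOp p q r) c (A : Matrix (BigIdx p q) (BigIdx p q) ℝ))
  map_lie' {A B} := LinearMap.ext fun f => Subtype.ext <| by
    rw [Ring.lie_def, LinearMap.sub_apply, Module.End.mul_apply, Module.End.mul_apply]
    exact confOp_lie_apply p q r A B f

/-- The higher harmonics as a module over `𝔰𝔬(p+1,q+1)`. -/
instance instLieRingModuleHarmonics (p q r : ℕ) : LieRingModule (SO p q) (higherHarmonics p q r) :=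
  LieRingModule.compLieHom _ (rep p q r)

instance instLieModuleHarmonics (p q r : ℕ) : LieModule ℝ (SO p q) (higherHarmonics p q r) :=
  LieModule.compLieHom _ (rep p q r)

/-- The socle of a module over a Lie algebra: the sum of its simple submodules. -/
def socle (R L M : Type*) [CommRing R] [LieRing L] [LieAlgebra R L] [AddCommGroup M] [Module R M]
    [LieRingModule L M] [LieModule R L M] : LieSubmodule R L M :=
  sSup {N : LieSubmodule R L M | LieModule.IsIrreducible R L N}

end

end HigherHarmonics

/-! The space `higherHarmonics p q r` is the direct sum of the layers F^i H_m with i < r, where H_m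
is the space of harmonic polynomials of degree m. Each layer is irreducible under the rotations
D_{jk}. Two layers of the same polynomial degree have different m, hence different eigenvalues of
the rotation Casimir, so every submodule is spanned by the layers that it contains
(`IsConfStable.le_iSup_layer`, `layer_le_of_mem`). The classification of submodules thus becomes a
question about which layer is reached from which.

The remaining operators move between neighbouring layers. On F^i H_m, ∂_j has components in F^(i-1)
H_(m+1) and F^i H_(m-1), while Q_j has components in F^i H_(m+1) and F^(i+1) H_(m-1)
(`pderiv_quadForm_pow_succ_mul`, `qOp_quadForm_pow_mul`). With the total weight i + m, two of these
four moves keep the weight, one lowers it and one raises it. The coefficient of the raising move is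
a nonzero multiple of i + m + d; that of Q_j into F^(i+1) H_(m-1) is a multiple of r - 1 - i, which
vanishes only at the edge i = r - 1. So all layers of equal weight generate each other, lower
weights are always reached, and the ascent can stop only at weight r - n/2.

If r - n/2 is not a natural number, nothing stops the ascent and the module is simple. If it is, the
layers of weight at most r - n/2 (`lowLayers`) form a finite-dimensional submodule contained in
every nonzero submodule, and a submodule with a layer above that weight is everything. This makes
`lowLayers` the socle and the quotient simple.

The irreducibility of H_m (`harmonics_le_of_rot_stable`) has to hold for an indefinite form over the
reals, so it is proved algebraically, without compactness or highest weights: a nonzero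
rotation-stable space contains a nonzero zonal polynomial, which is a nonzero multiple of X_e^m
modulo F, and rotations carry X_e^m to every monomial of degree m modulo F. -/

namespace HigherHarmonics

open MvPolynomial

noncomputable section

/-! ### Eigenvector splitting, and kernels of powers of a lowering operator. -/

section Abstract

variable {V : Type*} [AddCommGroup V] [Module ℝ V]

/-- If a submodule stable under `T` contains a sum of eigenvectors of `T` with distinct
eigenvalues, it contains each of them. -/
theorem mem_of_sum_eigenvector_mem {ι : Type*} {T : Module.End ℝ V} {N : Submodule ℝ V}
    (hN : ∀ x ∈ N, T x ∈ N) {μ : ι → ℝ} (hμ : Function.Injective μ) (s : Finset ι) :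
    ∀ x : ι → V, (∀ i ∈ s, T (x i) = μ i • x i) → ∑ i ∈ s, x i ∈ N → ∀ i ∈ s, x i ∈ N := by
  classical
  induction s using Finset.induction_on with
  | empty => simp
  | insert a s ha ih =>
    intro x hx hs
    -- The operator T - μ_a keeps N stable and kills the summand x_a, leaving a sum of rescaled
    -- eigenvectors over the smaller index set.
    have h1 : ∑ i ∈ s, (μ i - μ a) • x i ∈ N := by
      have h2 := N.sub_mem (hN _ hs) (N.smul_mem (μ a) hs)
      rw [map_sum, Finset.smul_sum, ← Finset.sum_sub_distrib, Finset.sum_insert ha,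
        hx a (Finset.mem_insert_self _ _), sub_self, zero_add] at h2
      convert h2 using 1
      refine Finset.sum_congr rfl fun i hi => ?_
      rw [hx i (Finset.mem_insert_of_mem hi), sub_smul]
    have h2 : ∀ i ∈ s, x i ∈ N := by
      intro i hi
      have h3 := ih (fun i => (μ i - μ a) • x i) (fun i hi => by
        rw [map_smul, hx i (Finset.mem_insert_of_mem hi), smul_comm]) h1 i hi
      have h4 : μ i - μ a ≠ 0 := sub_ne_zero.2 fun h => ha (hμ h ▸ hi)
      exact (N.smul_mem_iff h4).1 h3
    intro i hi
    rcases Finset.mem_insert.1 hi with rfl | hi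
    · rw [Finset.sum_insert ha] at hs
      exact (N.add_mem_iff_left (N.sum_mem h2)).1 hs
    · exact h2 i hi

theorem exists_sum_mem_inf {ι : Type*} {T : Module.End ℝ V} {N : Submodule ℝ V}
    (hN : ∀ x ∈ N, T x ∈ N) {μ : ι → ℝ} (hμ : Function.Injective μ) {P : ι → Submodule ℝ V}
    (hP : ∀ i, ∀ x ∈ P i, T x = μ i • x) {x : V} (hx : x ∈ N) (hxP : x ∈ ⨆ i, P i) :
    ∃ (s : Finset ι) (y : ι → V), (∀ i ∈ s, y i ∈ N ∧ y i ∈ P i) ∧ x = ∑ i ∈ s, y i := by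
  obtain ⟨f, hf, rfl⟩ := (Submodule.mem_iSup_iff_exists_finsupp _ _).1 hxP
  exact ⟨f.support, f, fun i hi => ⟨mem_of_sum_eigenvector_mem hN hμ f.support f
    (fun j _ => hP j _ (hf j)) hx i hi, hf i⟩, rfl⟩

theorem mem_iSup_inf {ι : Type*} {T : Module.End ℝ V} {N : Submodule ℝ V}
    (hN : ∀ x ∈ N, T x ∈ N) {μ : ι → ℝ} (hμ : Function.Injective μ) {P : ι → Submodule ℝ V}
    (hP : ∀ i, ∀ x ∈ P i, T x = μ i • x) {x : V} (hx : x ∈ N) (hxP : x ∈ ⨆ i, P i) :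
    x ∈ ⨆ i, N ⊓ P i := by
  obtain ⟨s, y, hy, rfl⟩ := exists_sum_mem_inf hN hμ hP hx hxP
  exact Submodule.sum_mem _ fun i hi => Submodule.mem_iSup_of_mem (p := fun i => N ⊓ P i) i (hy i hi)

variable {F L : Module.End ℝ V} {G : ℕ → Submodule ℝ V} {ν : ℝ}

theorem pow_mem_graded (hF : ∀ k, ∀ v ∈ G k, F v ∈ G (k + 2)) (i : ℕ) :
    ∀ k, ∀ v ∈ G k, (F ^ i) v ∈ G (2 * i + k) := by
  induction i with
  | zero => intro k v hv; simpa using hv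
  | succ i ih =>
    intro k v hv
    rw [pow_succ', Module.End.mul_apply]
    have := hF _ _ (ih k v hv)
    rwa [show 2 * i + k + 2 = 2 * (i + 1) + k by ring] at this

/-- The action of the lowering operator on `F ^ (i + 1) h` with `L h = 0`. -/
theorem lower_pow_succ (hF : ∀ k, ∀ v ∈ G k, F v ∈ G (k + 2))
    (hLF : ∀ k, ∀ v ∈ G k, L (F v) = F (L v) + (4 * k + 2 * ν) • v)
    {m : ℕ} {h : V} (hm : h ∈ G m) (h0 : L h = 0) (i : ℕ) :
    L ((F ^ (i + 1)) h) = ((i + 1) * (4 * m + 2 * ν + 4 * i)) • (F ^ i) h := by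
  induction i with
  | zero => simp [hLF m h hm, h0]
  | succ i ih =>
    rw [pow_succ', Module.End.mul_apply, hLF _ _ (pow_mem_graded hF (i + 1) m h hm), ih, map_smul,
      ← Module.End.mul_apply, ← pow_succ', ← add_smul]
    congr 1
    push_cast
    ring

/-- Decomposition of the kernel of a power of the lowering operator. -/
theorem mem_iSup_of_lower_pow_eq_zero (hν : 0 < ν) (hF : ∀ k, ∀ v ∈ G k, F v ∈ G (k + 2))
    (hL : ∀ k, ∀ v ∈ G (k + 2), L v ∈ G k) (hL0 : ∀ v ∈ G 0, L v = 0) (hL1 : ∀ v ∈ G 1, L v = 0)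
    (hLF : ∀ k, ∀ v ∈ G k, L (F v) = F (L v) + (4 * k + 2 * ν) • v) (r : ℕ) :
    ∀ k, ∀ v ∈ G k, (L ^ r) v = 0 →
      v ∈ ⨆ x : {x : ℕ × ℕ // x.1 < r ∧ 2 * x.1 + x.2 = k},
        (G x.1.2 ⊓ LinearMap.ker L).map (F ^ x.1.1) := by
  have hker : ∀ r k v, v ∈ G k → L v = 0 →
      v ∈ ⨆ x : {x : ℕ × ℕ // x.1 < r + 1 ∧ 2 * x.1 + x.2 = k},
        (G x.1.2 ⊓ LinearMap.ker L).map (F ^ x.1.1) := fun r k v hv h0 =>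
    Submodule.mem_iSup_of_mem ⟨(0, k), by simp, by simp⟩ ⟨v, ⟨hv, h0⟩, by simp⟩
  induction r with
  | zero =>
    intro k v _ h0
    rw [show v = 0 from h0]
    exact zero_mem _
  | succ r ih =>
    intro k v hv h0
    rcases k with _ | _ | k
    · exact hker r 0 v hv (hL0 v hv)
    · exact hker r 1 v hv (hL1 v hv)
    · have hLv : (L ^ r) (L v) = 0 := by rw [← Module.End.mul_apply, ← pow_succ]; exact h0
      -- Each summand F^i h of L v is c⁻¹ L (F^(i+1) h), so L v is lifted to some w of the required
      -- form; then v - w lies in the kernel of L and contributes the term with i = 0.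
      have key : ∀ u ∈ ⨆ x : {x : ℕ × ℕ // x.1 < r ∧ 2 * x.1 + x.2 = k},
          (G x.1.2 ⊓ LinearMap.ker L).map (F ^ x.1.1),
          ∃ w ∈ ⨆ x : {x : ℕ × ℕ // x.1 < r + 1 ∧ 2 * x.1 + x.2 = k + 2},
            (G x.1.2 ⊓ LinearMap.ker L).map (F ^ x.1.1), w ∈ G (k + 2) ∧ L w = u := by
        intro u hu
        refine Submodule.iSup_induction _ (motive := fun u => ∃ w ∈ ⨆ x : {x : ℕ × ℕ //
          x.1 < r + 1 ∧ 2 * x.1 + x.2 = k + 2}, (G x.1.2 ⊓ LinearMap.ker L).map (F ^ x.1.1),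
          w ∈ G (k + 2) ∧ L w = u) hu ?_ ⟨0, zero_mem _, zero_mem _, map_zero _⟩ ?_
        · intro x u hu
          obtain ⟨⟨i, m⟩, hi, him⟩ := x
          obtain ⟨h, ⟨hm, h1⟩, rfl⟩ := hu
          simp only at hi him hm ⊢
          have hc : ((i : ℝ) + 1) * (4 * m + 2 * ν + 4 * i) ≠ 0 := by positivity
          refine ⟨(((i : ℝ) + 1) * (4 * m + 2 * ν + 4 * i))⁻¹ • (F ^ (i + 1)) h,
            Submodule.smul_mem _ _ (Submodule.mem_iSup_of_mem
              ⟨(i + 1, m), by simpa using hi, by simp only; omega⟩ ⟨h, ⟨hm, h1⟩, rfl⟩),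
            Submodule.smul_mem _ _ ?_, ?_⟩
          · have := pow_mem_graded hF (i + 1) m h hm
            rwa [show 2 * (i + 1) + m = k + 2 by omega] at this
          · rw [map_smul, lower_pow_succ hF hLF hm h1, smul_smul, inv_mul_cancel₀ hc, one_smul]
        · intro u u' hu hu'
          obtain ⟨w, h1, h2, rfl⟩ := hu
          obtain ⟨w', h1', h2', rfl⟩ := hu'
          exact ⟨w + w', add_mem h1 h1', add_mem h2 h2', map_add _ _ _⟩
      obtain ⟨w, hw, hwG, hw2⟩ := key _ (ih k _ (hL k v hv) hLv)
      have h3 := hker r (k + 2) (v - w) (sub_mem hv hwG) (by rw [map_sub, hw2, sub_self])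
      simpa using add_mem h3 hw

/-- Each application of L drops the degree by two and L kills degrees 0 and 1, so r > k applications
are more than enough. This brings every homogeneous vector within reach of the decomposition above.
-/
theorem lower_pow_graded_eq_zero (hL : ∀ k, ∀ v ∈ G (k + 2), L v ∈ G k)
    (hL0 : ∀ v ∈ G 0, L v = 0) (hL1 : ∀ v ∈ G 1, L v = 0) (r : ℕ) :
    ∀ k < r, ∀ v ∈ G k, (L ^ r) v = 0 := by
  induction r with
  | zero => intro k hk; omega
  | succ r ih =>
    intro k hk v hv
    rw [pow_succ, Module.End.mul_apply]
    rcases k with _ | _ | k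
    · rw [hL0 v hv, map_zero]
    · rw [hL1 v hv, map_zero]
    · exact ih k (by omega) _ (hL k v hv)

end Abstract

/-! ### Quadratic form, Euler operator, Laplacian and Casimir operator in a subset of the variables.
-/

section Operators

variable {p q : ℕ}

/-- The part of the quadratic form that involves the variables in `J`. -/
def quadOn (J : Finset (Idx p q)) : Poly p q := ∑ j ∈ J, C (sgn j) * X j ^ 2

/-- The Euler operator of the variables in `J`. -/
def eulerOn (J : Finset (Idx p q)) : Module.End ℝ (Poly p q) := ∑ j ∈ J, mulOp (X j) * dOp j

/-- The Laplacian `∑ η_j ∂_j ^ 2` in the variables in `J`. -/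
def lapOn (J : Finset (Idx p q)) : Module.End ℝ (Poly p q) := ∑ j ∈ J, sgn j • dOp j ^ 2

theorem eulerOn_apply (J : Finset (Idx p q)) (f : Poly p q) :
    eulerOn J f = ∑ j ∈ J, X j * pderiv j f := by
  simp [eulerOn, mulOp_apply, dOp_apply, LinearMap.sum_apply]

theorem lapOn_apply (J : Finset (Idx p q)) (f : Poly p q) :
    lapOn J f = ∑ j ∈ J, C (sgn j) * pderiv j (pderiv j f) := by
  simp only [lapOn, LinearMap.smul_apply, LinearMap.sum_apply, MvPolynomial.smul_eq_C_mul, pow_two,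
    Module.End.mul_apply, dOp_apply]

theorem lapOn_C_mul (J : Finset (Idx p q)) (c : ℝ) (f : Poly p q) :
    lapOn J (C c * f) = C c * lapOn J f := by
  rw [← smul_eq_C_mul, map_smul, smul_eq_C_mul]

theorem eulerOn_C_mul (J : Finset (Idx p q)) (c : ℝ) (f : Poly p q) :
    eulerOn J (C c * f) = C c * eulerOn J f := by
  rw [← smul_eq_C_mul, map_smul, smul_eq_C_mul]

theorem C_sgn_mul_self (j : Idx p q) : (C (sgn j) * C (sgn j) : Poly p q) = 1 := by
  rw [← C_mul, sgn_mul_self, C_1]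

theorem pderiv_X_eq (i j : Idx p q) :
    pderiv i (X j : Poly p q) = if i = j then 1 else 0 := by
  split_ifs with h
  · rw [h, pderiv_X_self]
  · exact pderiv_X_of_ne (Ne.symm h)

theorem eulerOn_mul (J : Finset (Idx p q)) (f g : Poly p q) :
    eulerOn J (f * g) = eulerOn J f * g + f * eulerOn J g := by
  simp only [eulerOn_apply, Finset.sum_mul, Finset.mul_sum, ← Finset.sum_add_distrib, pderiv_mul]
  exact Finset.sum_congr rfl fun j _ => by ring

theorem eulerOn_X (J : Finset (Idx p q)) (i : Idx p q) :
    eulerOn J (X i) = if i ∈ J then X i else 0 := by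
  rw [eulerOn_apply, ← Finset.sum_ite_eq' J i fun j => (X j : Poly p q)]
  refine Finset.sum_congr rfl fun j _ => ?_
  rw [pderiv_X_eq]
  split_ifs <;> simp

theorem eulerOn_quadOn (J K : Finset (Idx p q)) :
    eulerOn J (quadOn K) = 2 * quadOn (K ∩ J) := by
  rw [quadOn, map_sum, quadOn, ← Finset.filter_mem_eq_inter, Finset.sum_filter, Finset.mul_sum]
  refine Finset.sum_congr rfl fun j _ => ?_
  rw [eulerOn_C_mul, pow_two, eulerOn_mul, eulerOn_X]
  split_ifs <;> ring

theorem lapOn_X_mul (J : Finset (Idx p q)) (i : Idx p q) (f : Poly p q) :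
    lapOn J (X i * f)
      = X i * lapOn J f + if i ∈ J then 2 * (C (sgn i) * pderiv i f) else 0 := by
  have h : ∀ j, C (sgn j) * pderiv j (pderiv j (X i * f))
      = X i * (C (sgn j) * pderiv j (pderiv j f))
        + if j = i then 2 * (C (sgn i) * pderiv i f) else 0 := by
    intro j
    rw [pderiv_mul, map_add, pderiv_mul, pderiv_mul, pderiv_X_eq]
    split_ifs with hj
    · subst hj
      rw [Derivation.map_one_eq_zero]
      ring
    · rw [map_zero]
      ring
  rw [lapOn_apply, lapOn_apply, Finset.sum_congr rfl fun j _ => h j, Finset.sum_add_distrib,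
    Finset.mul_sum, Finset.sum_ite_eq']

theorem lapOn_pderiv (J : Finset (Idx p q)) (i : Idx p q) (f : Poly p q) :
    lapOn J (pderiv i f) = pderiv i (lapOn J f) := by
  rw [lapOn_apply, lapOn_apply, map_sum]
  refine Finset.sum_congr rfl fun j _ => ?_
  rw [pderiv_C_mul, pderiv_comm j i f, pderiv_comm j i]

theorem lapOn_eulerOn (J K : Finset (Idx p q)) (f : Poly p q) :
    lapOn J (eulerOn K f) = eulerOn K (lapOn J f) + 2 * lapOn (K ∩ J) f := by
  rw [eulerOn_apply, eulerOn_apply, lapOn_apply (K ∩ J), map_sum, ← Finset.filter_mem_eq_inter,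
    Finset.sum_filter, Finset.mul_sum, ← Finset.sum_add_distrib]
  refine Finset.sum_congr rfl fun j _ => ?_
  rw [lapOn_X_mul, lapOn_pderiv]
  split_ifs <;> ring

/-- This is the commutation relation of the 𝔰𝔩₂ spanned by the quadratic form, the Laplacian and a
shift of the Euler operator; it feeds the hypothesis `hLF` of the abstract decomposition. -/
theorem lapOn_quadOn_mul (J : Finset (Idx p q)) (f : Poly p q) :
    lapOn J (quadOn J * f)
      = quadOn J * lapOn J f + 4 * eulerOn J f + 2 * (J.card : Poly p q) * f := by
  have h : ∀ j ∈ J, lapOn J (C (sgn j) * X j ^ 2 * f)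
      = C (sgn j) * X j ^ 2 * lapOn J f + (4 * (X j * pderiv j f) + 2 * f) := by
    intro j hj
    have e := C_sgn_mul_self j
    rw [show C (sgn j) * X j ^ 2 * f = C (sgn j) * (X j * (X j * f)) by ring, lapOn_C_mul,
      lapOn_X_mul, lapOn_X_mul, if_pos hj, if_pos hj, pderiv_mul, pderiv_X_self]
    linear_combination (4 * (X j * pderiv j f) + 2 * f) * e
  rw [quadOn, Finset.sum_mul, map_sum, Finset.sum_congr rfl h,
    Finset.sum_add_distrib, Finset.sum_add_distrib, ← Finset.mul_sum, ← eulerOn_apply,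
    ← Finset.sum_mul, Finset.sum_const, nsmul_eq_mul]
  ring

theorem pderiv_eulerOn (J : Finset (Idx p q)) (j : Idx p q) (f : Poly p q) :
    pderiv j (eulerOn J f) = eulerOn J (pderiv j f) + if j ∈ J then pderiv j f else 0 := by
  have h : ∀ i, pderiv j (X i * pderiv i f)
      = X i * pderiv i (pderiv j f) + if j = i then pderiv j f else 0 := by
    intro i
    rw [pderiv_mul, pderiv_X_eq, pderiv_comm j i]
    split_ifs with hi
    · subst hi
      ring
    · ring
  rw [eulerOn_apply, eulerOn_apply, map_sum, Finset.sum_congr rfl fun i _ => h i,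
    Finset.sum_add_distrib, Finset.sum_ite_eq]

theorem coeff_X_mul_pderiv (j : Idx p q) (f : Poly p q) (α : Idx p q →₀ ℕ) :
    coeff α (X j * pderiv j f) = α j * coeff α f := by
  classical
  rw [coeff_X_mul']
  split_ifs with h
  · have h1 : Finsupp.single j 1 ≤ α := by
      rw [Finsupp.single_le_iff]
      exact Nat.one_le_iff_ne_zero.2 (Finsupp.mem_support_iff.1 h)
    rw [coeff_pderiv, tsub_add_cancel_of_le h1]
    have h2 : 1 ≤ α j := Finsupp.single_le_iff.1 h1
    simp only [Finsupp.coe_tsub, Pi.sub_apply, Finsupp.single_eq_same]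
    push_cast [h2]
    ring
  · rw [Finsupp.notMem_support_iff.1 h]
    simp

theorem coeff_eulerOn (J : Finset (Idx p q)) (f : Poly p q) (α : Idx p q →₀ ℕ) :
    coeff α (eulerOn J f) = (∑ j ∈ J, α j : ℕ) * coeff α f := by
  rw [eulerOn_apply, coeff_sum, Nat.cast_sum, Finset.sum_mul]
  exact Finset.sum_congr rfl fun j _ => coeff_X_mul_pderiv j f α

theorem eulerOn_monomial (J : Finset (Idx p q)) (α : Idx p q →₀ ℕ) (c : ℝ) :
    eulerOn J (monomial α c) = ((∑ j ∈ J, α j : ℕ) : ℝ) • monomial α c := by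
  ext β
  rw [coeff_eulerOn, coeff_smul, coeff_monomial, smul_eq_mul]
  split_ifs with h
  · rw [h]
  · rw [mul_zero, mul_zero]

theorem coeff_eq_zero_of_eulerOn {J : Finset (Idx p q)} {f : Poly p q} {c : ℝ}
    (hf : eulerOn J f = c • f) {α : Idx p q →₀ ℕ} (hα : ((∑ j ∈ J, α j : ℕ) : ℝ) ≠ c) :
    coeff α f = 0 := by
  have h := congrArg (coeff α) hf
  rw [coeff_eulerOn, coeff_smul, smul_eq_mul, ← sub_eq_zero, ← sub_mul] at h
  exact (mul_eq_zero.1 h).resolve_left (sub_ne_zero.2 hα)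

/-- The Euler operator is diagonal on monomials with nonnegative eigenvalues. This replaces degree
bookkeeping wherever a derivative would land in negative degree. -/
theorem eq_zero_of_eulerOn_neg {J : Finset (Idx p q)} {f : Poly p q} {c : ℝ} (hc : c < 0)
    (hf : eulerOn J f = c • f) : f = 0 := by
  ext α
  rw [coeff_zero]
  exact coeff_eq_zero_of_eulerOn hf (ne_of_gt (hc.trans_le (Nat.cast_nonneg _)))

theorem rotOp_mul (j k : Idx p q) (f g : Poly p q) :
    rotOp j k (f * g) = rotOp j k f * g + f * rotOp j k g := by
  simp only [rotOp_apply, pderiv_mul]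
  ring

theorem pderiv_quadOn (J : Finset (Idx p q)) (j : Idx p q) :
    pderiv j (quadOn J) = if j ∈ J then 2 * (C (sgn j) * X j) else 0 := by
  rw [quadOn, map_sum, ← Finset.sum_ite_eq J j fun j => 2 * (C (sgn j) * X j)]
  refine Finset.sum_congr rfl fun i _ => ?_
  rw [pderiv_C_mul, pow_two, pderiv_mul, pderiv_X_eq]
  split_ifs with h
  · subst h
    ring
  · ring

theorem rotOp_quadOn {J : Finset (Idx p q)} {j k : Idx p q} (hj : j ∈ J) (hk : k ∈ J) :
    rotOp j k (quadOn J) = 0 := by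
  rw [rotOp_apply, pderiv_quadOn, pderiv_quadOn, if_pos hj, if_pos hk, C_mul]
  linear_combination (-2 * X j * X k * C (sgn k)) * C_sgn_mul_self j

/-- The Casimir operator of the rotations in the variables in `J`. -/
def casimirOn (J : Finset (Idx p q)) : Module.End ℝ (Poly p q) :=
  (1 / 2 : ℝ) • ∑ j ∈ J, ∑ k ∈ J, (sgn j * sgn k) • (rotOp j k * rotOp j k)

/-- A Capelli-type identity: the Casimir operator is expressed through the 𝔰𝔩₂ that commutes with
the rotations, so on harmonic polynomials it acts by a scalar that depends on the degree only. -/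
theorem casimirOn_apply (J : Finset (Idx p q)) (f : Poly p q) :
    casimirOn J f = quadOn J * lapOn J f - eulerOn J (eulerOn J f)
      - ((J.card : ℝ) - 2) • eulerOn J f := by
  -- The squared rotation splits into two pairs of terms exchanged by swapping j and k; the double
  -- sum therefore doubles one of each pair, which cancels the factor 1/2.
  have h1 : ∀ j k, C (sgn j * sgn k) * rotOp j k (rotOp j k f)
      = (C (sgn j * sgn k) * (X j * pderiv k (X j * pderiv k f))
        + C (sgn k * sgn j) * (X k * pderiv j (X k * pderiv j f)))
        - (X j * pderiv k (X k * pderiv j f) + X k * pderiv j (X j * pderiv k f)) := by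
    intro j k
    have e : (C (sgn j * sgn k) * C (sgn j * sgn k) : Poly p q) = 1 := by
      rw [C_mul]
      linear_combination C_sgn_mul_self j * C (sgn k) * C (sgn k) + C_sgn_mul_self k
    rw [rotOp_apply, rotOp_apply, map_sub, map_sub, pderiv_C_mul, pderiv_C_mul,
      mul_comm (sgn k) (sgn j)]
    linear_combination (C (sgn j * sgn k) * (X k * pderiv j (X k * pderiv j f))
      - X j * pderiv k (X k * pderiv j f) - X k * pderiv j (X j * pderiv k f)) * e
  have h2 : ∑ j ∈ J, ∑ k ∈ J, C (sgn j * sgn k) * (X j * pderiv k (X j * pderiv k f))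
      = quadOn J * lapOn J f + eulerOn J f := by
    rw [quadOn, lapOn_apply, eulerOn_apply, Finset.sum_mul, ← Finset.sum_add_distrib]
    refine Finset.sum_congr rfl fun j hj => ?_
    have : ∀ k, C (sgn j * sgn k) * (X j * pderiv k (X j * pderiv k f))
        = C (sgn j) * X j ^ 2 * (C (sgn k) * pderiv k (pderiv k f))
          + if k = j then X j * pderiv j f else 0 := by
      intro k
      rw [pderiv_mul, pderiv_X_eq, C_mul]
      split_ifs with h
      · subst h
        linear_combination (X k * pderiv k f) * C_sgn_mul_self k
      · ring
    rw [Finset.sum_congr rfl fun k _ => this k, Finset.sum_add_distrib, Finset.sum_ite_eq',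
      if_pos hj, Finset.mul_sum]
  have h3 : ∑ j ∈ J, ∑ k ∈ J, X j * pderiv k (X k * pderiv j f)
      = eulerOn J (eulerOn J f) + ((J.card : Poly p q) - 1) * eulerOn J f := by
    have : ∀ j ∈ J, ∑ k ∈ J, X j * pderiv k (X k * pderiv j f)
        = X j * pderiv j (eulerOn J f) + ((J.card : Poly p q) - 1) * (X j * pderiv j f) := by
      intro j hj
      rw [pderiv_eulerOn, if_pos hj, eulerOn_apply, ← Finset.mul_sum]
      have : ∀ k, pderiv k (X k * pderiv j f) = X k * pderiv k (pderiv j f) + pderiv j f := by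
        intro k
        rw [pderiv_mul, pderiv_X_self]
        ring
      rw [Finset.sum_congr rfl fun k _ => this k, Finset.sum_add_distrib, Finset.sum_const,
        nsmul_eq_mul]
      ring
    rw [Finset.sum_congr rfl this, Finset.sum_add_distrib, ← Finset.mul_sum, ← eulerOn_apply,
      ← eulerOn_apply]
  have h4 : casimirOn J f
      = C (1 / 2) * ∑ j ∈ J, ∑ k ∈ J, C (sgn j * sgn k) * rotOp j k (rotOp j k f) := by
    simp only [casimirOn, LinearMap.smul_apply, LinearMap.sum_apply, smul_eq_C_mul,
      Module.End.mul_apply]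
  have h5 := half (p := p) (q := q)
  have h6 : (C ((J.card : ℝ) - 2) : Poly p q) = (J.card : Poly p q) - 2 := by
    rw [C_sub, map_natCast, map_ofNat]
  simp only [h1, Finset.sum_sub_distrib, Finset.sum_add_distrib] at h4
  rw [Finset.sum_comm (f := fun j k => C (sgn k * sgn j) * (X k * pderiv j (X k * pderiv j f))),
    Finset.sum_comm (f := fun j k => X k * pderiv j (X j * pderiv k f)), h2, h3] at h4
  rw [h4, smul_eq_C_mul, h6]
  linear_combination (quadOn J * lapOn J f - eulerOn J (eulerOn J f)
      - ((J.card : Poly p q) - 2) * eulerOn J f) * h5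

theorem casimirOn_mem {J : Finset (Idx p q)} {N : Submodule ℝ (Poly p q)}
    (hN : ∀ j ∈ J, ∀ k ∈ J, ∀ f ∈ N, rotOp j k f ∈ N) {f : Poly p q} (hf : f ∈ N) :
    casimirOn J f ∈ N := by
  simp only [casimirOn, LinearMap.smul_apply, LinearMap.sum_apply, Module.End.mul_apply]
  exact N.smul_mem _ (N.sum_mem fun j hj => N.sum_mem fun k hk =>
    N.smul_mem _ (hN j hj k hk _ (hN j hj k hk _ hf)))

theorem casimirOn_quadOn_mul (J : Finset (Idx p q)) (f : Poly p q) :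
    casimirOn J (quadOn J * f) = quadOn J * casimirOn J f := by
  have h : ∀ j ∈ J, ∀ k ∈ J, ∀ f, rotOp j k (quadOn J * f) = quadOn J * rotOp j k f := by
    intro j hj k hk f
    rw [rotOp_mul, rotOp_quadOn hj hk, zero_mul, zero_add]
  simp only [casimirOn, LinearMap.smul_apply, LinearMap.sum_apply, Module.End.mul_apply]
  rw [mul_smul_comm, Finset.mul_sum]
  congr 1
  refine Finset.sum_congr rfl fun j hj => ?_
  rw [Finset.mul_sum]
  refine Finset.sum_congr rfl fun k hk => ?_
  rw [h j hj k hk, h j hj k hk, mul_smul_comm]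

theorem mulOp_pow_apply (g f : Poly p q) (i : ℕ) : (mulOp g ^ i) f = g ^ i * f := by
  induction i with
  | zero => simp
  | succ i ih => rw [pow_succ', Module.End.mul_apply, ih, mulOp_apply, pow_succ', mul_assoc]

/-- The eigenvalue of the Casimir operator on a harmonic polynomial times a power of the
quadratic form. -/
theorem casimirOn_quadOn_pow_mul {J : Finset (Idx p q)} {h : Poly p q} {l : ℕ}
    (h0 : lapOn J h = 0) (hl : eulerOn J h = (l : ℝ) • h) (i : ℕ) :
    casimirOn J (quadOn J ^ i * h) = (-(l * (l + ((J.card : ℝ) - 2)))) • (quadOn J ^ i * h) := by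
  induction i with
  | zero =>
    rw [pow_zero, one_mul, casimirOn_apply, h0, hl, map_smul, hl, mul_zero]
    module
  | succ i ih => rw [pow_succ', mul_assoc, casimirOn_quadOn_mul, ih, mul_smul_comm]

/-- The difference of two eigenvalues factors as (a - b)(a + b + c) up to sign. Here c is the number
of variables minus 2; it is nonnegative for the full set of variables and, because n ≥ 3, also after
removing one. -/
theorem casimir_eigenvalue_injective {c : ℝ} (hc : 0 ≤ c) :
    Function.Injective fun l : ℕ => -((l : ℝ) * (l + c)) := by
  intro a b h
  have h1 : ((a : ℝ) - b) * (a + b + c) = 0 := by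
    simp only at h
    linear_combination -h
  rcases mul_eq_zero.1 h1 with h2 | h2
  · exact_mod_cast sub_eq_zero.1 h2
  · have ha : (0 : ℝ) ≤ a := Nat.cast_nonneg a
    have hb : (0 : ℝ) ≤ b := Nat.cast_nonneg b
    have ha' : (a : ℝ) = 0 := by linarith
    have hb' : (b : ℝ) = 0 := by linarith
    exact_mod_cast ha'.trans hb'.symm

end Operators

/-! ### Fischer decomposition into powers of the form times harmonics. -/

section Harmonic

variable {p q : ℕ}

/-- The polynomials that are homogeneous of degree `k` in the variables in `J` and of degree `a` in
the variables in `K`. -/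
def bigraded (J K : Finset (Idx p q)) (a k : ℕ) : Submodule ℝ (Poly p q) :=
  Module.End.eigenspace (eulerOn J) (k : ℝ) ⊓ Module.End.eigenspace (eulerOn K) (a : ℝ)

theorem mem_bigraded {J K : Finset (Idx p q)} {a k : ℕ} {f : Poly p q} :
    f ∈ bigraded J K a k ↔ eulerOn J f = (k : ℝ) • f ∧ eulerOn K f = (a : ℝ) • f := by
  rw [bigraded, Submodule.mem_inf, Module.End.mem_eigenspace_iff, Module.End.mem_eigenspace_iff]

theorem eulerOn_quadOn_self_mul (J : Finset (Idx p q)) (f : Poly p q) :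
    eulerOn J (quadOn J * f) = quadOn J * (eulerOn J f + 2 * f) := by
  rw [eulerOn_mul, eulerOn_quadOn, Finset.inter_self]
  ring

theorem quadOn_mul_mem_bigraded {J K : Finset (Idx p q)} (hJK : J ∩ K = ∅) {a k : ℕ}
    {f : Poly p q} (hf : f ∈ bigraded J K a k) : quadOn J * f ∈ bigraded J K a (k + 2) := by
  rw [mem_bigraded] at hf ⊢
  have h2 : (2 : Poly p q) = C 2 := (map_ofNat C 2).symm
  rw [eulerOn_quadOn_self_mul, eulerOn_mul, eulerOn_quadOn, hJK, hf.1, hf.2]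
  simp only [smul_eq_C_mul, quadOn, Finset.sum_empty]
  push_cast
  rw [C_add, ← h2]
  constructor <;> ring

theorem lapOn_mem_bigraded {J K : Finset (Idx p q)} (hJK : J ∩ K = ∅) {a k : ℕ}
    {f : Poly p q} (hf : f ∈ bigraded J K a (k + 2)) : lapOn J f ∈ bigraded J K a k := by
  rw [mem_bigraded] at hf ⊢
  have h2 : (2 : Poly p q) = C 2 := (map_ofNat C 2).symm
  have h3 : lapOn (∅ : Finset (Idx p q)) f = 0 := by simp [lapOn]
  have e1 := lapOn_eulerOn J J f
  have e2 := lapOn_eulerOn J K f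
  rw [hf.1, Finset.inter_self, map_smul, smul_eq_C_mul] at e1
  rw [hf.2, Finset.inter_comm, hJK, h3, map_smul, smul_eq_C_mul] at e2
  push_cast at e1
  rw [C_add, ← h2] at e1
  simp only [smul_eq_C_mul]
  exact ⟨by linear_combination -e1, by linear_combination -e2⟩

/-- The Laplacian of f would be homogeneous of the negative degree k - 2. -/
theorem lapOn_eq_zero_of_lt_two {J : Finset (Idx p q)} {k : ℕ} (hk : k < 2)
    {f : Poly p q} (hf : eulerOn J f = (k : ℝ) • f) : lapOn J f = 0 := by
  have h2 : (2 : Poly p q) = C 2 := (map_ofNat C 2).symm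
  have e1 := lapOn_eulerOn J J f
  rw [hf, Finset.inter_self, map_smul, smul_eq_C_mul] at e1
  refine eq_zero_of_eulerOn_neg (J := J) (c := (k : ℝ) - 2) ?_ ?_
  · have : (k : ℝ) < 2 := by exact_mod_cast hk
    linarith
  · rw [smul_eq_C_mul, C_sub, ← h2]
    linear_combination -e1

theorem lapOn_quadOn_mul_bigraded {J K : Finset (Idx p q)} {a k : ℕ}
    {f : Poly p q} (hf : f ∈ bigraded J K a k) :
    lapOn J (mulOp (quadOn J) f)
      = mulOp (quadOn J) (lapOn J f) + (4 * (k : ℝ) + 2 * (J.card : ℝ)) • f := by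
  rw [mem_bigraded] at hf
  rw [mulOp_apply, mulOp_apply, lapOn_quadOn_mul, hf.1, smul_eq_C_mul, smul_eq_C_mul]
  simp only [C_add, C_mul, map_ofNat, map_natCast]
  ring

/-- The variables in K are spectators whose degree a stays fixed. Both uses matter: J everything
with K empty, and J the complement of one coordinate e with K = {e}. -/
theorem mem_iSup_of_lapOn_pow_eq_zero {J K : Finset (Idx p q)} (hJK : J ∩ K = ∅)
    (hJ : J.Nonempty) (r : ℕ) {a k : ℕ} {f : Poly p q} (hf : f ∈ bigraded J K a k)
    (h0 : (lapOn J ^ r) f = 0) :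
    f ∈ ⨆ x : {x : ℕ × ℕ // x.1 < r ∧ 2 * x.1 + x.2 = k},
      (bigraded J K a x.1.2 ⊓ LinearMap.ker (lapOn J)).map (mulOp (quadOn J) ^ x.1.1) :=
  mem_iSup_of_lower_pow_eq_zero (F := mulOp (quadOn J)) (L := lapOn J) (G := bigraded J K a)
    (ν := (J.card : ℝ)) (by exact_mod_cast hJ.card_pos)
    (fun _ _ hv => quadOn_mul_mem_bigraded hJK hv) (fun _ _ hv => lapOn_mem_bigraded hJK hv)
    (fun _ hv => lapOn_eq_zero_of_lt_two (by norm_num) (mem_bigraded.1 hv).1)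
    (fun _ hv => lapOn_eq_zero_of_lt_two (by norm_num) (mem_bigraded.1 hv).1)
    (fun _ _ hv => lapOn_quadOn_mul_bigraded hv) r k f hf h0

theorem lapOn_pow_bigraded_eq_zero {J K : Finset (Idx p q)} (hJK : J ∩ K = ∅)
    {a k : ℕ} {f : Poly p q} (hf : f ∈ bigraded J K a k) : (lapOn J ^ (k + 1)) f = 0 :=
  lower_pow_graded_eq_zero (G := bigraded J K a)
    (fun _ _ hv => lapOn_mem_bigraded hJK hv)
    (fun _ hv => lapOn_eq_zero_of_lt_two (by norm_num) (mem_bigraded.1 hv).1)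
    (fun _ hv => lapOn_eq_zero_of_lt_two (by norm_num) (mem_bigraded.1 hv).1) (k + 1) k
    (Nat.lt_succ_self k) f hf

theorem monomial_mem_bigraded (J K : Finset (Idx p q)) (α : Idx p q →₀ ℕ) (c : ℝ) :
    monomial α c ∈ bigraded J K (∑ j ∈ K, α j) (∑ j ∈ J, α j) :=
  mem_bigraded.2 ⟨eulerOn_monomial J α c, eulerOn_monomial K α c⟩

/-- The homogeneous polynomials of degree `k`. -/
def graded (p q k : ℕ) : Submodule ℝ (Poly p q) :=
  Module.End.eigenspace (eulerOn Finset.univ) (k : ℝ)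

theorem mem_graded {k : ℕ} {f : Poly p q} :
    f ∈ graded p q k ↔ eulerOn Finset.univ f = (k : ℝ) • f := Module.End.mem_eigenspace_iff

theorem bigraded_univ (k : ℕ) : bigraded (Finset.univ : Finset (Idx p q)) ∅ 0 k = graded p q k := by
  ext f
  rw [mem_bigraded, mem_graded]
  simp [eulerOn]

/-- The harmonic polynomials of degree `m`. -/
def harmonics (p q m : ℕ) : Submodule ℝ (Poly p q) :=
  graded p q m ⊓ LinearMap.ker (lapOn Finset.univ)

theorem mem_harmonics {m : ℕ} {f : Poly p q} :
    f ∈ harmonics p q m ↔ eulerOn Finset.univ f = (m : ℝ) • f ∧ lapOn Finset.univ f = 0 := by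
  rw [harmonics, Submodule.mem_inf, mem_graded, LinearMap.mem_ker]

theorem quadOn_univ : quadOn Finset.univ = quadForm p q := rfl

/-- The products of the `i`-th power of the quadratic form with harmonics of degree `m`. -/
def layer (p q i m : ℕ) : Submodule ℝ (Poly p q) :=
  (harmonics p q m).map (mulOp (quadForm p q) ^ i)

theorem mem_layer {i m : ℕ} {f : Poly p q} :
    f ∈ layer p q i m ↔ ∃ h ∈ harmonics p q m, quadForm p q ^ i * h = f := by
  simp only [layer, Submodule.mem_map, mulOp_pow_apply]

theorem mem_iSup_layer [Nonempty (Idx p q)] {r k : ℕ} {f : Poly p q} (hf : f ∈ graded p q k)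
    (h0 : (lapOn Finset.univ ^ r) f = 0) :
    f ∈ ⨆ x : {x : ℕ × ℕ // x.1 < r ∧ 2 * x.1 + x.2 = k}, layer p q x.1.1 x.1.2 := by
  rw [← bigraded_univ] at hf
  have := mem_iSup_of_lapOn_pow_eq_zero (by simp) Finset.univ_nonempty r hf h0
  simp only [bigraded_univ] at this
  exact this

theorem monomial_mem_graded (α : Idx p q →₀ ℕ) (c : ℝ) :
    monomial α c ∈ graded p q (∑ j, α j) := mem_graded.2 (eulerOn_monomial _ α c)

theorem lapOn_quadForm_pow_mul {m : ℕ} {h : Poly p q} (hh : h ∈ harmonics p q m) (i : ℕ) :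
    lapOn Finset.univ (quadForm p q ^ (i + 1) * h)
      = (((i : ℝ) + 1) * (4 * m + 2 * ((p : ℝ) + q) + 4 * i)) • (quadForm p q ^ i * h) := by
  have hh' : h ∈ bigraded (Finset.univ : Finset (Idx p q)) ∅ 0 m := by
    rw [bigraded_univ]
    exact hh.1
  have := lower_pow_succ (F := mulOp (quadOn Finset.univ))
    (G := bigraded (Finset.univ : Finset (Idx p q)) ∅ 0)
    (ν := ((Finset.univ : Finset (Idx p q)).card : ℝ))
    (fun _ _ hv => quadOn_mul_mem_bigraded (by simp) hv)
    (fun _ _ hv => lapOn_quadOn_mul_bigraded hv) hh' hh.2 i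
  rw [mulOp_pow_apply, mulOp_pow_apply] at this
  simpa [quadOn_univ] using this

/-- Multiplication by the quadratic form followed by the Laplacian is injective. -/
theorem eq_zero_of_lapOn_quadForm_mul [Nonempty (Idx p q)] {f : Poly p q}
    (hf : lapOn Finset.univ (quadForm p q * f) = 0) : f = 0 := by
  set T : Module.End ℝ (Poly p q) := lapOn Finset.univ * mulOp (quadForm p q) with hT
  have hpq : (0 : ℝ) < (p : ℝ) + q := by
    have : 0 < Fintype.card (Idx p q) := Fintype.card_pos
    simp only [Fintype.card_sum, Fintype.card_fin] at this
    exact_mod_cast this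
  -- The operator f ↦ Δ(F f) acts on each F^i h by a positive scalar, so every polynomial is a sum
  -- of eigenvectors with nonzero eigenvalues, and independence of eigenspaces makes the kernel
  -- trivial.
  have h1 : f ∈ ⨆ μ : ℝ, ⨆ _ : μ ≠ 0, T.eigenspace μ := by
    rw [f.as_sum]
    refine Submodule.sum_mem _ fun α _ => ?_
    have hm := monomial_mem_graded α (coeff α f)
    have h0 := lapOn_pow_bigraded_eq_zero (Finset.inter_empty _) (bigraded_univ (p := p) (q := q) _ ▸ hm)
    refine SetLike.le_def.1 (iSup_le fun x => ?_) (mem_iSup_layer hm h0)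
    intro _ hx
    obtain ⟨h, hh, rfl⟩ := mem_layer.1 hx
    have h2 : ((x.1.1 : ℝ) + 1) * (4 * x.1.2 + 2 * ((p : ℝ) + q) + 4 * x.1.1) ≠ 0 := by positivity
    refine Submodule.mem_iSup_of_mem _ (Submodule.mem_iSup_of_mem h2 ?_)
    rw [Module.End.mem_eigenspace_iff, hT, Module.End.mul_apply, mulOp_apply, ← mul_assoc,
      ← pow_succ', lapOn_quadForm_pow_mul hh]
  have h2 : f ∈ T.eigenspace 0 := by
    rw [Module.End.mem_eigenspace_iff, zero_smul]
    exact hf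
  exact Submodule.disjoint_def.1 (T.eigenspaces_iSupIndep 0) f h2 h1

end Harmonic

/-! ### Irreducibility of the harmonics of fixed degree under rotations. -/

section Irreducible

variable {p q : ℕ}

theorem eq_single_of_sum_eq {α : Idx p q →₀ ℕ} {e : Idx p q} {m : ℕ} (hα : ∑ j, α j = m)
    (he : m ≤ α e) : α = Finsupp.single e m := by
  have h1 := Finset.add_sum_erase Finset.univ (fun j => α j) (Finset.mem_univ e)
  have h2 : ∑ j ∈ Finset.univ.erase e, α j = 0 := by omega
  ext j
  rw [Finsupp.single_apply]
  split_ifs with hj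
  · subst hj
    omega
  · exact Finset.sum_eq_zero_iff.1 h2 j (Finset.mem_erase.2 ⟨Ne.symm hj, Finset.mem_univ j⟩)

theorem exists_eq_single_add {α : Idx p q →₀ ℕ} {e : Idx p q} {m : ℕ} (hα : ∑ j, α j = m)
    (he : α e < m) : ∃ j ≠ e, ∃ δ : Idx p q →₀ ℕ, α = Finsupp.single j 1 + δ := by
  have h1 := Finset.add_sum_erase Finset.univ (fun j => α j) (Finset.mem_univ e)
  have h2 : ∑ j ∈ Finset.univ.erase e, α j ≠ 0 := by omega
  obtain ⟨j, hj, hj2⟩ := Finset.exists_ne_zero_of_sum_ne_zero h2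
  refine ⟨j, (Finset.mem_erase.1 hj).1, α - Finsupp.single j 1, ?_⟩
  rw [add_tsub_cancel_of_le]
  rw [Finsupp.single_le_iff]
  omega

theorem X_mul_monomial (j : Idx p q) (δ : Idx p q →₀ ℕ) (c : ℝ) :
    X j * monomial δ c = monomial (Finsupp.single j 1 + δ) c := by
  rw [X, monomial_mul, one_mul]

theorem sum_single_add (j : Idx p q) (δ : Idx p q →₀ ℕ) :
    ∑ i, (Finsupp.single j 1 + δ : Idx p q →₀ ℕ) i = 1 + ∑ i, δ i := by
  simp only [Finsupp.add_apply, Finset.sum_add_distrib]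
  congr 1
  simp [Finsupp.single_apply]

/-- Induction on the defect m - α_e. The coefficient of X_e X^δ in D_{ej} f combines (δ_j + 1) times
that of X_j X^δ in f with a coefficient of f of larger e-exponent. Since D_{ej} f also lies in W,
everything except the first term vanishes by induction. -/
theorem eq_zero_of_coeff_single_eq_zero {W : Submodule ℝ (Poly p q)} (e : Idx p q)
    (hW : ∀ j, ∀ f ∈ W, rotOp e j f ∈ W) {m : ℕ}
    (h0 : ∀ f ∈ W, coeff (Finsupp.single e m) f = 0) (n : ℕ) :
    ∀ α : Idx p q →₀ ℕ, ∑ j, α j = m → m ≤ α e + n → ∀ f ∈ W, coeff α f = 0 := by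
  induction n using Nat.strong_induction_on with
  | _ n ih =>
  intro α hα hn f hf
  by_cases hm : m ≤ α e
  · rw [eq_single_of_sum_eq hα hm]
    exact h0 f hf
  obtain ⟨j, hj, δ, rfl⟩ := exists_eq_single_add hα (not_le.1 hm)
  rw [sum_single_add] at hα
  have hje : (Finsupp.single j 1 + δ : Idx p q →₀ ℕ) e = δ e := by
    rw [Finsupp.add_apply, Finsupp.single_eq_of_ne (Ne.symm hj), zero_add]
  rw [hje] at hn hm
  have h1 : coeff (Finsupp.single e 1 + δ) (rotOp e j f) = 0 := by
    refine ih (n - 1) (by omega) _ (by rw [sum_single_add, hα]) ?_ _ (hW j f hf)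
    rw [Finsupp.add_apply, Finsupp.single_eq_same]
    omega
  have h2 : coeff (Finsupp.single e 1 + δ) (X j * pderiv e f) = 0 := by
    by_cases hδ : δ j = 0
    · rw [coeff_X_mul', if_neg]
      rw [Finsupp.notMem_support_iff, Finsupp.add_apply, hδ, Finsupp.single_eq_of_ne hj, add_zero]
    · have h3 : δ = Finsupp.single j 1 + (δ - Finsupp.single j 1) := by
        rw [add_tsub_cancel_of_le]
        rw [Finsupp.single_le_iff]
        omega
      set γ := δ - Finsupp.single j 1
      have h4 : γ e = δ e := by
        rw [h3, Finsupp.add_apply, Finsupp.single_eq_of_ne (Ne.symm hj), zero_add]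
      rw [h3, add_left_comm, coeff_X_mul, coeff_pderiv,
        ih (n - 1) (by omega) _ _ _ f hf, zero_mul]
      · rw [add_comm _ (Finsupp.single e 1), sum_single_add, sum_single_add, ← hα, h3,
          sum_single_add]
      · rw [add_comm _ (Finsupp.single e 1), Finsupp.add_apply, Finsupp.add_apply,
          Finsupp.single_eq_same]
        omega
  rw [rotOp_apply, coeff_sub, coeff_C_mul, h2, mul_zero, sub_zero, coeff_X_mul, coeff_pderiv,
    add_comm δ] at h1
  exact (mul_eq_zero.1 h1).resolve_right (by positivity)

/-- The dual induction: applied to X_e X^δ, the rotation D_{ej} gives a nonzero multiple of X_j X^δ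
plus a multiple of a monomial with a larger exponent at e. -/
theorem monomial_mem_of_rot_stable {U : Submodule ℝ (Poly p q)} (e : Idx p q)
    (hU : ∀ j, ∀ f ∈ U, rotOp e j f ∈ U) {m : ℕ} (hm : monomial (Finsupp.single e m) 1 ∈ U)
    (n : ℕ) : ∀ α : Idx p q →₀ ℕ, ∑ j, α j = m → m ≤ α e + n → monomial α 1 ∈ U := by
  induction n using Nat.strong_induction_on with
  | _ n ih =>
  intro α hα hn
  by_cases hm : m ≤ α e
  · rw [eq_single_of_sum_eq hα hm]
    assumption
  obtain ⟨j, hj, δ, rfl⟩ := exists_eq_single_add hα (not_le.1 hm)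
  rw [sum_single_add] at hα
  have hje : (Finsupp.single j 1 + δ : Idx p q →₀ ℕ) e = δ e := by
    rw [Finsupp.add_apply, Finsupp.single_eq_of_ne (Ne.symm hj), zero_add]
  rw [hje] at hn hm
  have h1 : monomial (Finsupp.single e 1 + δ) 1 ∈ U := by
    refine ih (n - 1) (by omega) _ (by rw [sum_single_add, hα]) ?_
    rw [Finsupp.add_apply, Finsupp.single_eq_same]
    omega
  have h2 : X e * pderiv j (monomial (Finsupp.single e 1 + δ) (1 : ℝ)) ∈ U := by
    rw [pderiv_monomial, X_mul_monomial, one_mul, Finsupp.add_apply,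
      Finsupp.single_eq_of_ne hj, zero_add]
    by_cases hδ : δ j = 0
    · rw [hδ, Nat.cast_zero, monomial_zero]
      exact U.zero_mem
    · have h3 : δ = Finsupp.single j 1 + (δ - Finsupp.single j 1) := by
        rw [add_tsub_cancel_of_le]
        rw [Finsupp.single_le_iff]
        omega
      set γ := δ - Finsupp.single j 1
      have h4 : γ e = δ e := by
        rw [h3, Finsupp.add_apply, Finsupp.single_eq_of_ne (Ne.symm hj), zero_add]
      rw [← mul_one ((δ j : ℕ) : ℝ), ← smul_eq_mul, ← smul_monomial]
      refine U.smul_mem _ (ih (n - 1) (by omega) _ ?_ ?_)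
      · rw [h3, add_left_comm, add_tsub_cancel_left, sum_single_add, sum_single_add, ← hα, h3,
          sum_single_add]
      · rw [h3, add_left_comm, add_tsub_cancel_left, Finsupp.add_apply, Finsupp.add_apply,
          Finsupp.single_eq_same]
        omega
  have h3 := U.sub_mem h2 (hU j _ h1)
  have h4 : X e * pderiv j (monomial (Finsupp.single e 1 + δ) (1 : ℝ))
      - rotOp e j (monomial (Finsupp.single e 1 + δ) 1)
      = (sgn e * sgn j * ((δ e : ℝ) + 1)) • monomial (Finsupp.single j 1 + δ) 1 := by
    rw [rotOp_apply, sub_sub_cancel, pderiv_monomial, add_tsub_cancel_left, X_mul_monomial,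
      C_mul_monomial, smul_monomial, Finsupp.add_apply, Finsupp.single_eq_same]
    congr 1
    push_cast
    rw [smul_eq_mul]
    ring
  rw [h4] at h3
  refine (U.smul_mem_iff (mul_ne_zero (mul_ne_zero ?_ ?_) (by positivity))).1 h3
  · exact left_ne_zero_of_mul_eq_one (sgn_mul_self e)
  · exact left_ne_zero_of_mul_eq_one (sgn_mul_self j)

theorem rotOp_quadForm_mul (j k : Idx p q) (f : Poly p q) :
    rotOp j k (quadForm p q * f) = quadForm p q * rotOp j k f := by
  rw [rotOp_mul, ← quadOn_univ, rotOp_quadOn (Finset.mem_univ j) (Finset.mem_univ k), zero_mul,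
    zero_add]

/-- Every monomial in the image of this Casimir operator involves a variable other than X_e. Hence
eigenvectors with nonzero eigenvalue do not see the coefficient of X_e^m. -/
theorem coeff_single_casimirOn (e : Idx p q) (m : ℕ) (f : Poly p q) :
    coeff (Finsupp.single e m) (casimirOn (Finset.univ.erase e) f) = 0 := by
  have h1 : ∑ j ∈ Finset.univ.erase e, (Finsupp.single e m : Idx p q →₀ ℕ) j = 0 :=
    Finset.sum_eq_zero fun j hj => Finsupp.single_eq_of_ne (Finset.mem_erase.1 hj).1
  have h2 : coeff (Finsupp.single e m) (quadOn (Finset.univ.erase e)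
      * lapOn (Finset.univ.erase e) f) = 0 := by
    rw [quadOn, Finset.sum_mul, coeff_sum]
    refine Finset.sum_eq_zero fun j hj => ?_
    rw [pow_two, mul_assoc, mul_assoc, coeff_C_mul, coeff_X_mul', if_neg, mul_zero]
    rw [Finsupp.notMem_support_iff]
    exact Finsupp.single_eq_of_ne (Finset.mem_erase.1 hj).1
  rw [casimirOn_apply, coeff_sub, coeff_sub, coeff_smul, coeff_eulerOn, coeff_eulerOn, h1, h2]
  simp

/-- A homogeneous polynomial is a sum of eigenvectors of the Casimir operator of the rotations that
fix the coordinate `X_e`. -/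
theorem mem_iSup_casimirOn (e : Idx p q) (hn : 2 ≤ p + q) {m : ℕ} {f : Poly p q}
    (hf : f ∈ graded p q m) :
    f ∈ ⨆ l : ℕ, (if l = 0
      then Submodule.span ℝ {g | ∃ a b, a + 2 * b = m ∧
        g = X e ^ a * quadOn (Finset.univ.erase e) ^ b}
      else Module.End.eigenspace (casimirOn (Finset.univ.erase e))
        (-((l : ℝ) * (l + (((Finset.univ.erase e).card : ℝ) - 2))))) := by
  have hJ : (Finset.univ.erase e).Nonempty := by
    rw [← Finset.card_pos, Finset.card_erase_of_mem (Finset.mem_univ e), Finset.card_univ,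
      Fintype.card_sum, Fintype.card_fin, Fintype.card_fin]
    omega
  have hJK : Finset.univ.erase e ∩ {e} = ∅ := by simp
  rw [f.as_sum]
  refine Submodule.sum_mem _ fun α hα => ?_
  have hm : ∑ j, α j = m := by
    by_contra h
    refine mem_support_iff.1 hα (coeff_eq_zero_of_eulerOn (mem_graded.1 hf) ?_)
    exact_mod_cast h
  rw [← Finset.add_sum_erase Finset.univ (fun j => α j) (Finset.mem_univ e)] at hm
  have h1 := monomial_mem_bigraded (Finset.univ.erase e) {e} α (coeff α f)
  rw [Finset.sum_singleton] at h1
  refine SetLike.le_def.1 (iSup_le fun x => ?_)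
    (mem_iSup_of_lapOn_pow_eq_zero hJK hJ _ h1 (lapOn_pow_bigraded_eq_zero hJK h1))
  obtain ⟨⟨i, l⟩, -, hx⟩ := x
  rintro _ ⟨h, ⟨hh, h0⟩, rfl⟩
  rw [SetLike.mem_coe, mem_bigraded] at hh
  rw [SetLike.mem_coe, LinearMap.mem_ker] at h0
  simp only at hh hx ⊢
  rw [mulOp_pow_apply]
  refine Submodule.mem_iSup_of_mem l ?_
  split_ifs with hl
  · subst hl
    -- For l = 0 the factor h has degree 0 in the variables other than X_e, so it is a multiple of a
    -- power of X_e and the product is zonal.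
    have h2 : h = coeff (Finsupp.single e (α e)) h • X e ^ α e := by
      ext β
      rw [coeff_smul, coeff_X_pow, smul_eq_mul]
      split_ifs with hβ
      · rw [← hβ, mul_one]
      · rw [mul_zero]
        by_cases h3 : ∑ j ∈ Finset.univ.erase e, β j = 0
        · refine coeff_eq_zero_of_eulerOn hh.2 fun h4 => hβ ?_
          rw [Finset.sum_singleton, Nat.cast_inj] at h4
          refine (eq_single_of_sum_eq ?_ h4.ge).symm
          rw [← Finset.add_sum_erase Finset.univ (fun j => β j) (Finset.mem_univ e), h3, h4,
            add_zero]
        · refine coeff_eq_zero_of_eulerOn hh.1 ?_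
          exact_mod_cast h3
    rw [h2, mul_smul_comm, mul_comm]
    exact Submodule.smul_mem _ _ (Submodule.subset_span ⟨α e, i, by omega, rfl⟩)
  · rw [Module.End.mem_eigenspace_iff]
    exact casimirOn_quadOn_pow_mul h0 hh.1 i

/-- Modulo the quadratic form, a zonal polynomial is a multiple of a power of the coordinate. -/
theorem exists_eq_add_quadForm_mul (e : Idx p q) {m : ℕ} {f : Poly p q}
    (hf : f ∈ Submodule.span ℝ {g | ∃ a b, a + 2 * b = m ∧
      g = X e ^ a * quadOn (Finset.univ.erase e) ^ b}) :
    ∃ (c : ℝ) (g : Poly p q), f = c • X e ^ m + quadForm p q * g := by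
  induction hf using Submodule.span_induction with
  | mem f hf =>
    obtain ⟨a, b, hab, rfl⟩ := hf
    have h1 : quadOn (Finset.univ.erase e) - (-(C (sgn e) * X e ^ 2)) = quadForm p q := by
      rw [quadForm, ← Finset.add_sum_erase Finset.univ _ (Finset.mem_univ e), quadOn]
      ring
    -- Modulo F, the form in the other variables equals -η_e X_e², and a - b divides a^k - b^k.
    obtain ⟨g, hg⟩ := sub_dvd_pow_sub_pow (quadOn (Finset.univ.erase e))
      (-(C (sgn e) * X e ^ 2)) b
    rw [h1] at hg
    refine ⟨(-sgn e) ^ b, X e ^ a * g, ?_⟩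
    rw [sub_eq_iff_eq_add.1 hg, smul_eq_C_mul, ← hab, C_pow, C_neg, pow_add, pow_mul, ← neg_mul,
      mul_pow]
    ring
  | zero => exact ⟨0, 0, by simp⟩
  | add f f' _ _ hf hf' =>
    obtain ⟨c, g, rfl⟩ := hf
    obtain ⟨c', g', rfl⟩ := hf'
    exact ⟨c + c', g + g', by rw [add_smul]; ring⟩
  | smul t f _ hf =>
    obtain ⟨c, g, rfl⟩ := hf
    exact ⟨t * c, t • g, by rw [smul_add, mul_smul, mul_smul_comm]⟩

/-- The harmonics of a fixed degree are irreducible under rotations. -/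
theorem harmonics_le_of_rot_stable (hn : 3 ≤ p + q) {m : ℕ} {W : Submodule ℝ (Poly p q)}
    (hW : ∀ j k, ∀ f ∈ W, rotOp j k f ∈ W) (hle : W ≤ harmonics p q m) (hne : W ≠ ⊥) :
    harmonics p q m ≤ W := by
  have hcard : Fintype.card (Idx p q) = p + q := by simp
  have hI : Nonempty (Idx p q) := Fintype.card_pos_iff.1 (by omega)
  obtain ⟨e⟩ := hI
  have hI : Nonempty (Idx p q) := ⟨e⟩
  set J : Finset (Idx p q) := Finset.univ.erase e with hJdef
  have hJ : (0 : ℝ) ≤ (J.card : ℝ) - 2 := by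
    have : 2 ≤ J.card := by
      rw [Finset.card_erase_of_mem (Finset.mem_univ e), Finset.card_univ, hcard]
      omega
    have : (2 : ℝ) ≤ J.card := by exact_mod_cast this
    linarith
  obtain ⟨f, hf, hfe⟩ : ∃ f ∈ W, coeff (Finsupp.single e m) f ≠ 0 := by
    by_contra! h
    obtain ⟨f, hf, hf0⟩ := W.ne_bot_iff.1 hne
    refine hf0 ?_
    ext α
    rw [coeff_zero]
    by_cases hα : ∑ j, α j = m
    · exact eq_zero_of_coeff_single_eq_zero e (hW e) h m α hα (by omega) f hf
    · refine coeff_eq_zero_of_eulerOn (mem_harmonics.1 (hle hf)).1 ?_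
      exact_mod_cast hα
  -- Splitting f inside W by the Casimir of the rotations fixing X_e, some component has a nonzero
  -- X_e^m coefficient, which forces it to be the zonal one.
  obtain ⟨f₀, hf₀, hf₀e, hf₀z⟩ : ∃ f₀ ∈ W, f₀ ≠ 0 ∧ f₀ ∈ Submodule.span ℝ
      {g | ∃ a b, a + 2 * b = m ∧ g = X e ^ a * quadOn (Finset.univ.erase e) ^ b} := by
    obtain ⟨s, y, hy, rfl⟩ := exists_sum_mem_inf (T := casimirOn J) (N := W)
      (μ := fun l : ℕ => -((l : ℝ) * (l + ((J.card : ℝ) - 2))))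
      (fun x hx => casimirOn_mem (fun j _ k _ => hW j k) hx) (casimir_eigenvalue_injective hJ)
      (fun l x hx => by
        split_ifs at hx with hl
        · subst hl
          rw [Nat.cast_zero, zero_mul, neg_zero, zero_smul]
          refine (Submodule.span_le (p := LinearMap.ker (casimirOn J))).2 ?_ hx
          rintro _ ⟨a, b, -, rfl⟩
          have hX : ∀ a : ℕ, eulerOn J (X e ^ a) = ((0 : ℕ) : ℝ) • X e ^ a
              ∧ lapOn J (X e ^ a) = 0 := by
            intro a
            have h1 : eulerOn J (X e ^ a) = ((0 : ℕ) : ℝ) • X e ^ a := by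
              rw [X_pow_eq_monomial, eulerOn_monomial]
              congr 2
              exact Finset.sum_eq_zero fun j hj =>
                Finsupp.single_eq_of_ne (Finset.mem_erase.1 hj).1
            exact ⟨h1, lapOn_eq_zero_of_lt_two (by norm_num) h1⟩
          rw [SetLike.mem_coe, LinearMap.mem_ker, mul_comm,
            casimirOn_quadOn_pow_mul (hX a).2 (hX a).1]
          simp
        · exact Module.End.mem_eigenspace_iff.1 hx)
      hf (mem_iSup_casimirOn e (by omega) (hle hf).1)
    rw [coeff_sum] at hfe
    obtain ⟨l, hl, hl0⟩ := Finset.exists_ne_zero_of_sum_ne_zero hfe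
    have hyl := (hy l hl).2
    split_ifs at hyl with h
    · exact ⟨y l, (hy l hl).1, fun h0 => hl0 (by rw [h0, coeff_zero]), hyl⟩
    · refine absurd ?_ hl0
      have h1 := coeff_single_casimirOn e m (y l)
      rw [Module.End.mem_eigenspace_iff.1 hyl, coeff_smul, smul_eq_mul] at h1
      refine (mul_eq_zero.1 h1).resolve_left ?_
      have : (0 : ℝ) < l := by exact_mod_cast Nat.pos_of_ne_zero h
      have : (0 : ℝ) < l * (l + ((J.card : ℝ) - 2)) := by positivity
      exact neg_ne_zero.2 this.ne'
  -- A harmonic polynomial divisible by F is zero, so congruence modulo F between harmonics is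
  -- equality. This gives both c ≠ 0 below and the return from U to W at the end.
  have hker : ∀ f ∈ harmonics p q m, ∀ w ∈ W, ∀ g, f = w + quadForm p q * g → f = w := by
    intro f hf w hw g hfg
    have h1 : lapOn Finset.univ (quadForm p q * g) = 0 := by
      rw [← sub_eq_iff_eq_add'.2 hfg, map_sub, (mem_harmonics.1 hf).2,
        (mem_harmonics.1 (hle hw)).2, sub_zero]
    rw [hfg, eq_zero_of_lapOn_quadForm_mul h1, mul_zero, add_zero]
  -- Adding all multiples of F to W keeps rotation stability and lets the zonal element be replaced
  -- by X_e^m, at the price of working modulo F.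
  set U := W ⊔ LinearMap.range (mulOp (quadForm p q)) with hUdef
  have hU : ∀ j k, ∀ f ∈ U, rotOp j k f ∈ U := by
    intro j k f hf
    obtain ⟨w, hw, _, ⟨g, rfl⟩, rfl⟩ := Submodule.mem_sup.1 hf
    rw [map_add, mulOp_apply, rotOp_quadForm_mul]
    exact Submodule.add_mem_sup (hW j k w hw) ⟨rotOp j k g, rfl⟩
  have hX : monomial (Finsupp.single e m) 1 ∈ U := by
    obtain ⟨c, g, hcg⟩ := exists_eq_add_quadForm_mul e hf₀z
    have hc : c ≠ 0 := by
      rintro rfl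
      rw [zero_smul] at hcg
      exact hf₀e (hker f₀ (hle hf₀) 0 W.zero_mem g hcg)
    rw [← X_pow_eq_monomial]
    refine (U.smul_mem_iff hc).1 ?_
    rw [eq_sub_of_add_eq hcg.symm]
    exact U.sub_mem (Submodule.mem_sup_left hf₀) (Submodule.mem_sup_right ⟨g, rfl⟩)
  intro f hf
  have hfU : f ∈ U := by
    rw [f.as_sum]
    refine Submodule.sum_mem _ fun α hα => ?_
    have hm : ∑ j, α j = m := by
      by_contra h
      refine mem_support_iff.1 hα (coeff_eq_zero_of_eulerOn (mem_harmonics.1 hf).1 ?_)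
      exact_mod_cast h
    have h1 := monomial_mem_of_rot_stable e (hU e) hX m α hm (by omega)
    rw [← mul_one (coeff α f), ← smul_eq_mul, ← smul_monomial]
    exact U.smul_mem _ h1
  obtain ⟨w, hw, _, ⟨g, rfl⟩, hfg⟩ := Submodule.mem_sup.1 hfU
  rw [hker f hf w hw g hfg.symm]
  exact hw

end Irreducible

/-! ### Layers F^i H_m and the action of the operators on them. -/

section Layers

variable {p q : ℕ}

theorem euler_eq : euler p q = eulerOn Finset.univ := rfl

theorem lapOn_univ_eq : lapOn (Finset.univ : Finset (Idx p q)) = (2 : ℝ) • box p q := by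
  refine LinearMap.ext fun f => ?_
  rw [lapOn_apply, two_box, LinearMap.smul_apply, smul_eq_C_mul, map_ofNat]

theorem mem_higherHarmonics_iff {r : ℕ} {f : Poly p q} :
    f ∈ higherHarmonics p q r ↔ (lapOn Finset.univ ^ r) f = 0 := by
  rw [mem_higherHarmonics, lapOn_univ_eq, smul_pow, LinearMap.smul_apply,
    smul_eq_zero_iff_right (pow_ne_zero r two_ne_zero)]

theorem mem_harmonics_iff_higherHarmonics {m : ℕ} {f : Poly p q} :
    f ∈ harmonics p q m ↔ eulerOn Finset.univ f = (m : ℝ) • f ∧ f ∈ higherHarmonics p q 1 := by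
  rw [mem_harmonics, mem_higherHarmonics_iff, pow_one]

theorem eulerOn_rotOp (j k : Idx p q) (f : Poly p q) :
    eulerOn Finset.univ (rotOp j k f) = rotOp j k (eulerOn Finset.univ f) := by
  rw [rotOp_apply, rotOp_apply, map_sub, eulerOn_C_mul, eulerOn_mul, eulerOn_mul, eulerOn_X,
    eulerOn_X, pderiv_eulerOn, pderiv_eulerOn]
  simp only [Finset.mem_univ, if_true]
  ring

theorem rotOp_mem_harmonics {m : ℕ} (j k : Idx p q) {f : Poly p q} (hf : f ∈ harmonics p q m) :
    rotOp j k f ∈ harmonics p q m := by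
  rw [mem_harmonics_iff_higherHarmonics] at hf ⊢
  exact ⟨by rw [eulerOn_rotOp, hf.1, map_smul], rotOp_mem j k hf.2⟩

theorem eulerOn_pderiv {m : ℕ} (j : Idx p q) {f : Poly p q}
    (hf : eulerOn Finset.univ f = (m : ℝ) • f) :
    eulerOn Finset.univ (pderiv j f) = ((m : ℝ) - 1) • pderiv j f := by
  have h := pderiv_eulerOn Finset.univ j f
  rw [hf, if_pos (Finset.mem_univ j), Derivation.map_smul] at h
  rw [sub_smul, one_smul, h, add_sub_cancel_right]

theorem pderiv_eq_zero_of_mem_harmonics_zero (j : Idx p q) {f : Poly p q}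
    (hf : f ∈ harmonics p q 0) : pderiv j f = 0 :=
  eq_zero_of_eulerOn_neg (c := ((0 : ℕ) : ℝ) - 1) (by norm_num) (eulerOn_pderiv j (mem_harmonics.1 hf).1)

theorem pderiv_mem_harmonics_succ {m : ℕ} (j : Idx p q) {f : Poly p q}
    (hf : f ∈ harmonics p q (m + 1)) : pderiv j f ∈ harmonics p q m := by
  rw [mem_harmonics_iff_higherHarmonics] at hf ⊢
  refine ⟨?_, pderiv_mem j hf.2⟩
  rw [eulerOn_pderiv j hf.1]
  push_cast
  rw [add_sub_cancel_right]

theorem pderiv_mem_harmonics {m : ℕ} (j : Idx p q) {f : Poly p q} (hf : f ∈ harmonics p q m) :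
    pderiv j f ∈ harmonics p q (m - 1) := by
  rcases m with _ | m
  · rw [pderiv_eq_zero_of_mem_harmonics_zero j hf]
    exact zero_mem _
  · rw [add_tsub_cancel_right]
    exact pderiv_mem_harmonics_succ j hf

/-- The constant `1 / (2 m + n - 2)`. -/
def raiseCoeff (p q m : ℕ) : ℝ := (2 * (m : ℝ) + ((p : ℝ) + q) - 2)⁻¹

theorem raiseCoeff_pos (hn : 3 ≤ p + q) (m : ℕ) : 0 < raiseCoeff p q m := by
  have : (3 : ℝ) ≤ (p : ℝ) + q := by exact_mod_cast hn
  have : (0 : ℝ) ≤ m := Nat.cast_nonneg m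
  exact inv_pos.2 (by linarith)

theorem raiseCoeff_mul (hn : 3 ≤ p + q) (m : ℕ) :
    raiseCoeff p q m * (2 * (m : ℝ) + ((p : ℝ) + q) - 2) = 1 :=
  inv_mul_cancel₀ (inv_pos.1 (raiseCoeff_pos hn m)).ne'

/-- The harmonic projection of `X_j h`, for a harmonic polynomial `h` of degree `m`. -/
def raise (m : ℕ) (j : Idx p q) (h : Poly p q) : Poly p q :=
  X j * h - C (raiseCoeff p q m * sgn j) * (quadForm p q * pderiv j h)

theorem lapOn_quadForm_mul (f : Poly p q) :
    lapOn Finset.univ (quadForm p q * f) = quadForm p q * lapOn Finset.univ f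
      + 4 * eulerOn Finset.univ f + C (2 * ((p : ℝ) + q)) * f := by
  have := lapOn_quadOn_mul Finset.univ f
  rw [quadOn_univ, Finset.card_univ, Fintype.card_sum, Fintype.card_fin, Fintype.card_fin] at this
  rw [this, C_mul, C_add, map_natCast, map_natCast, map_ofNat]
  push_cast
  ring

theorem raise_mem_harmonics (hn : 3 ≤ p + q) {m : ℕ} (j : Idx p q) {h : Poly p q}
    (hh : h ∈ harmonics p q m) : raise m j h ∈ harmonics p q (m + 1) := by
  have hE := eulerOn_pderiv j (mem_harmonics.1 hh).1
  rw [smul_eq_C_mul, C_sub, C_1] at hE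
  rw [mem_harmonics] at hh ⊢
  have hE0 := hh.1
  rw [smul_eq_C_mul] at hE0
  have h1 : eulerOn Finset.univ (quadForm p q * pderiv j h)
      = quadForm p q * (eulerOn Finset.univ (pderiv j h) + 2 * pderiv j h) := by
    rw [← quadOn_univ, eulerOn_quadOn_self_mul]
  constructor
  · rw [raise, map_sub, eulerOn_C_mul, h1, hE, eulerOn_mul, eulerOn_X, if_pos (Finset.mem_univ j),
      hE0, smul_eq_C_mul]
    push_cast
    rw [C_add, C_1]
    ring
  · have h2 := congrArg (C : ℝ → Poly p q) (raiseCoeff_mul hn m)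
    simp only [C_mul, C_sub, C_add, C_1, map_ofNat] at h2
    rw [raise, map_sub, lapOn_C_mul, lapOn_X_mul, hh.2, if_pos (Finset.mem_univ j),
      lapOn_quadForm_mul, lapOn_pderiv, hh.2, map_zero, hE]
    simp only [C_mul, C_add, map_ofNat]
    linear_combination (-2 * C (sgn j) * pderiv j h) * h2

theorem sum_X_mul_pderiv {m : ℕ} {f : Poly p q} (hf : f ∈ harmonics p q m) :
    ∑ j, X j * pderiv j f = C (m : ℝ) * f := by
  rw [← eulerOn_apply, (mem_harmonics.1 hf).1, smul_eq_C_mul]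

/-- Euler's identity recovers (m + 1) f from its partial derivatives. -/
theorem exists_pderiv_ne_zero {m : ℕ} {f : Poly p q} (hf : f ∈ harmonics p q (m + 1))
    (h0 : f ≠ 0) : ∃ j, pderiv j f ≠ 0 := by
  by_contra! h
  have h1 := sum_X_mul_pderiv hf
  simp only [h, mul_zero, Finset.sum_const_zero] at h1
  rcases mul_eq_zero.1 h1.symm with h2 | h2
  · rw [C_eq_zero] at h2
    push_cast at h2
    have : (0 : ℝ) < (m : ℝ) + 1 := by positivity
    exact this.ne' h2
  · exact h0 h2

/-- The divergence of the raised family is a scalar multiple of f. This is the means of showing that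
not all raised polynomials vanish. -/
theorem sum_pderiv_raise {m : ℕ} {f : Poly p q} (hf : f ∈ harmonics p q m) :
    ∑ j, pderiv j (raise m j f)
      = C ((p : ℝ) + q + m - 2 * m * raiseCoeff p q m) * f := by
  have h1 : ∀ j, pderiv j (raise m j f) = f + (1 - 2 * C (raiseCoeff p q m)) * (X j * pderiv j f)
      - C (raiseCoeff p q m) * quadForm p q * (C (sgn j) * pderiv j (pderiv j f)) := by
    intro j
    have h2 : pderiv j (quadForm p q) = 2 * (C (sgn j) * X j) := by
      rw [← quadOn_univ, pderiv_quadOn, if_pos (Finset.mem_univ j)]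
    rw [raise, map_sub, pderiv_C_mul, pderiv_mul, pderiv_mul, pderiv_X_self, h2, C_mul]
    linear_combination (-2 * C (raiseCoeff p q m) * X j * pderiv j f) * C_sgn_mul_self j
  rw [Finset.sum_congr rfl fun j _ => h1 j, Finset.sum_sub_distrib, Finset.sum_add_distrib,
    ← Finset.mul_sum, ← Finset.mul_sum, ← lapOn_apply, (mem_harmonics.1 hf).2, sum_X_mul_pderiv hf,
    Finset.sum_const, Finset.card_univ, Fintype.card_sum, Fintype.card_fin, Fintype.card_fin]
  simp only [C_sub, C_add, C_mul, map_natCast, map_ofNat, nsmul_eq_mul]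
  push_cast
  ring

theorem exists_raise_ne_zero (hn : 3 ≤ p + q) {m : ℕ} {f : Poly p q} (hf : f ∈ harmonics p q m)
    (h0 : f ≠ 0) : ∃ j, raise m j f ≠ 0 := by
  by_contra! h
  have h1 := sum_pderiv_raise hf
  simp only [h, map_zero, Finset.sum_const_zero] at h1
  rcases mul_eq_zero.1 h1.symm with h2 | h2
  · rw [C_eq_zero] at h2
    have h3 : (3 : ℝ) ≤ (p : ℝ) + q := by exact_mod_cast hn
    have h4 : (0 : ℝ) ≤ m := Nat.cast_nonneg m
    have h5 := raiseCoeff_mul hn m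
    have h6 := raiseCoeff_pos hn m
    -- With c = `raiseCoeff p q m`, 2mc = 1 - (n - 2)c, so the scalar is n + m - 1 + (n - 2)c > 0.
    nlinarith [mul_pos h6 (by linarith : (0 : ℝ) < (p : ℝ) + q - 2)]
  · exact h0 h2

theorem harmonics_ne_bot (hn : 3 ≤ p + q) (m : ℕ) : ∃ h ∈ harmonics p q m, h ≠ 0 := by
  induction m with
  | zero =>
    have h1 : eulerOn Finset.univ (1 : Poly p q) = ((0 : ℕ) : ℝ) • 1 := by
      rw [eulerOn_apply]
      simp
    exact ⟨1, mem_harmonics.2 ⟨h1, lapOn_eq_zero_of_lt_two (by norm_num) h1⟩, one_ne_zero⟩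
  | succ m ih =>
    obtain ⟨h, hh, h0⟩ := ih
    obtain ⟨j, hj⟩ := exists_raise_ne_zero hn hh h0
    exact ⟨_, raise_mem_harmonics hn j hh, hj⟩

theorem pderiv_quadForm (j : Idx p q) : pderiv j (quadForm p q) = 2 * (C (sgn j) * X j) := by
  rw [← quadOn_univ, pderiv_quadOn, if_pos (Finset.mem_univ j)]

theorem pderiv_quadForm_pow_succ_mul (i m : ℕ) (j : Idx p q) (h : Poly p q) :
    pderiv j (quadForm p q ^ (i + 1) * h)
      = (2 * ((i : ℝ) + 1) * sgn j) • (quadForm p q ^ i * raise m j h)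
        + (1 + 2 * ((i : ℝ) + 1) * raiseCoeff p q m) • (quadForm p q ^ (i + 1) * pderiv j h) := by
  rw [pderiv_mul, pderiv_pow, pderiv_quadForm, raise, add_tsub_cancel_right]
  simp only [smul_eq_C_mul, C_add, C_mul, C_1, map_natCast, map_ofNat]
  push_cast
  linear_combination (2 * ((i : Poly p q) + 1) * quadForm p q ^ (i + 1) * C (raiseCoeff p q m)
    * pderiv j h) * C_sgn_mul_self j

theorem quadForm_mul_pderiv (i : ℕ) (j : Idx p q) (h : Poly p q) :
    quadForm p q * pderiv j (quadForm p q ^ i * h)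
      = 2 * (i : Poly p q) * C (sgn j) * (quadForm p q ^ i * (X j * h))
        + quadForm p q ^ (i + 1) * pderiv j h := by
  rw [pderiv_mul, pderiv_pow, pderiv_quadForm]
  rcases i with _ | i
  · simp
  · rw [add_tsub_cancel_right]
    ring

theorem eulerOn_quadForm_pow_mul {m : ℕ} {h : Poly p q}
    (hh : h ∈ graded p q m) (i : ℕ) :
    eulerOn Finset.univ (quadForm p q ^ i * h) = (2 * (i : ℝ) + m) • (quadForm p q ^ i * h) := by
  induction i with
  | zero => rw [pow_zero, one_mul, mem_graded.1 hh]; simp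
  | succ i ih =>
    rw [pow_succ', mul_assoc, ← quadOn_univ, eulerOn_quadOn_self_mul, quadOn_univ, ih]
    simp only [smul_eq_C_mul, C_add, C_mul, map_natCast, map_ofNat]
    push_cast
    ring

/-- The two coefficients govern the whole module structure: the first vanishes exactly at total
weight i + m = -d, and the second exactly at i = r - 1, which keeps the operator inside the layers
with i < r. -/
theorem qOp_quadForm_pow_mul (hn : 3 ≤ p + q) (r i : ℕ) (j : Idx p q) {m : ℕ} {h : Poly p q}
    (hh : h ∈ harmonics p q m) :
    qOp r j (quadForm p q ^ i * h)
      = (-2 * sgn j * ((i : ℝ) + m + wt p q r)) • (quadForm p q ^ i * raise m j h)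
        + (2 * ((r : ℝ) - 1 - i) * raiseCoeff p q m)
          • (quadForm p q ^ (i + 1) * pderiv j h) := by
  -- Since d = n/2 - r, the difference (2m + n - 2) - 2(i + m + d) equals 2(r - 1 - i).
  have h1 : 2 * ((r : ℝ) - 1 - i) * raiseCoeff p q m
      = 1 - 2 * ((i : ℝ) + m + wt p q r) * raiseCoeff p q m := by
    rw [wt]
    linear_combination raiseCoeff_mul hn m
  rw [h1, qOp_apply, euler_eq, eulerOn_quadForm_pow_mul hh.1, quadForm_mul_pderiv, raise]
  simp only [smul_eq_C_mul, C_sub, C_add, C_mul, C_neg, C_1, map_natCast, map_ofNat]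
  linear_combination (-2 * ((i : Poly p q) + m + C (wt p q r)) * quadForm p q ^ (i + 1)
    * C (raiseCoeff p q m) * pderiv j h) * C_sgn_mul_self j

theorem rotOp_quadForm_pow_mul (i : ℕ) (j k : Idx p q) (h : Poly p q) :
    rotOp j k (quadForm p q ^ i * h) = quadForm p q ^ i * rotOp j k h := by
  induction i with
  | zero => simp
  | succ i ih => rw [pow_succ', mul_assoc, rotOp_quadForm_mul, ih, mul_assoc]

theorem quadForm_ne_zero (hn : 1 ≤ p + q) : quadForm p q ≠ 0 := by
  intro h0
  have hI : Nonempty (Idx p q) := Fintype.card_pos_iff.1 (by simp; omega)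
  obtain ⟨j⟩ := hI
  have h1 := pderiv_quadForm j
  rw [h0, map_zero] at h1
  have h2 : sgn j ≠ 0 := left_ne_zero_of_mul_eq_one (sgn_mul_self j)
  have h3 : (C (sgn j) * X j : Poly p q) ≠ 0 := mul_ne_zero (by simpa using h2) (X_ne_zero j)
  exact mul_ne_zero two_ne_zero h3 h1.symm

theorem casimirOn_layer {i m : ℕ} {f : Poly p q} (hf : f ∈ layer p q i m) :
    casimirOn Finset.univ f
      = (-((m : ℝ) * (m + (((Finset.univ : Finset (Idx p q)).card : ℝ) - 2)))) • f := by
  obtain ⟨h, hh, rfl⟩ := mem_layer.1 hf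
  rw [mem_harmonics] at hh
  exact casimirOn_quadOn_pow_mul hh.2 hh.1 i

theorem two_le_card (hn : 3 ≤ p + q) :
    (0 : ℝ) ≤ ((Finset.univ : Finset (Idx p q)).card : ℝ) - 2 := by
  have : 3 ≤ (Finset.univ : Finset (Idx p q)).card := by simpa using hn
  have : (3 : ℝ) ≤ (Finset.univ : Finset (Idx p q)).card := by exact_mod_cast this
  linarith

/-- Different m means different Casimir eigenvalue, so the two components of ∂_j or Q_j on a layer
can be used separately. -/
theorem mem_of_add_mem {N : Submodule ℝ (Poly p q)} (hn : 3 ≤ p + q)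
    (hN : ∀ j k, ∀ f ∈ N, rotOp j k f ∈ N) {i m i' m' : ℕ} (hm : m ≠ m') {f g : Poly p q}
    (hf : f ∈ layer p q i m) (hg : g ∈ layer p q i' m') (hfg : f + g ∈ N) : f ∈ N ∧ g ∈ N := by
  have h1 := mem_of_sum_eigenvector_mem (T := casimirOn Finset.univ) (N := N)
    (fun x hx => casimirOn_mem (fun j _ k _ => hN j k) hx)
    (casimir_eigenvalue_injective (two_le_card hn)) {m, m'} (fun l => if l = m then f else g)
    (by
      intro l hl
      rcases Finset.mem_insert.1 hl with rfl | hl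
      · rw [if_pos rfl, casimirOn_layer hf]
      · rw [Finset.mem_singleton.1 hl, if_neg hm.symm, casimirOn_layer hg])
    (by rwa [Finset.sum_pair hm, if_pos rfl, if_neg hm.symm])
  have h2 := h1 m (by simp)
  have h3 := h1 m' (by simp)
  rw [if_pos rfl] at h2
  rw [if_neg hm.symm] at h3
  exact ⟨h2, h3⟩

/-- A space that is stable under rotations and contains a nonzero element of a layer contains the
whole layer. -/
theorem layer_le_of_mem {N : Submodule ℝ (Poly p q)} (hn : 3 ≤ p + q)
    (hN : ∀ j k, ∀ f ∈ N, rotOp j k f ∈ N) {i m : ℕ} {f : Poly p q}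
    (hf : f ∈ layer p q i m) (hfN : f ∈ N) (h0 : f ≠ 0) : layer p q i m ≤ N := by
  obtain ⟨h, hh, rfl⟩ := mem_layer.1 hf
  have h1 : harmonics p q m ≤ harmonics p q m ⊓ N.comap (mulOp (quadForm p q) ^ i) := by
    refine harmonics_le_of_rot_stable hn (fun j k g hg => ?_) inf_le_left ?_
    · refine ⟨rotOp_mem_harmonics j k hg.1, ?_⟩
      have h2 := hg.2
      rw [SetLike.mem_coe, Submodule.mem_comap, mulOp_pow_apply] at h2 ⊢
      rw [← rotOp_quadForm_pow_mul]
      exact hN j k _ h2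
    · refine (Submodule.ne_bot_iff _).2 ⟨h, ⟨hh, ?_⟩, right_ne_zero_of_mul h0⟩
      rw [SetLike.mem_coe, Submodule.mem_comap, mulOp_pow_apply]
      exact hfN
  exact Submodule.map_le_iff_le_comap.2 (h1.trans inf_le_right)

end Layers

/-! ### Stable spaces as unions of layers, and the moves between layers. -/

section Stable

variable {p q r : ℕ}

/-- Stability of a space of polynomials under the operators `E`, `∂_j`, `Q_j` and `D_{jk}`. -/
structure IsConfStable (r : ℕ) (N : Submodule ℝ (Poly p q)) : Prop where
  euler_mem : ∀ f ∈ N, euler p q f ∈ N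
  pderiv_mem : ∀ j, ∀ f ∈ N, pderiv j f ∈ N
  qOp_mem : ∀ j, ∀ f ∈ N, qOp r j f ∈ N
  rotOp_mem : ∀ j k, ∀ f ∈ N, rotOp j k f ∈ N

theorem isConfStable_higherHarmonics (p q r : ℕ) : IsConfStable r (higherHarmonics p q r) :=
  ⟨fun _ hf => euler_mem hf, fun j _ hf => HigherHarmonics.pderiv_mem j hf,
    fun j _ hf => HigherHarmonics.qOp_mem j hf, fun j k _ hf => HigherHarmonics.rotOp_mem j k hf⟩

theorem mem_iSup_graded (f : Poly p q) : f ∈ ⨆ k, graded p q k := by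
  rw [f.as_sum]
  exact Submodule.sum_mem _ fun α _ =>
    Submodule.mem_iSup_of_mem _ (monomial_mem_graded α (coeff α f))

namespace IsConfStable

variable {N : Submodule ℝ (Poly p q)}

/-- The Euler operator separates the polynomial degrees, and within one degree the Casimir operator
separates the layers. -/
theorem le_iSup_layer (hN : IsConfStable r N) (hn : 3 ≤ p + q) (hle : N ≤ higherHarmonics p q r) :
    N ≤ ⨆ x : {x : ℕ × ℕ // x.1 < r}, N ⊓ layer p q x.1.1 x.1.2 := by
  have hI : Nonempty (Idx p q) := Fintype.card_pos_iff.1 (by simp; omega)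
  intro f hf
  have h1 := mem_iSup_inf (T := eulerOn Finset.univ) hN.euler_mem
    (μ := fun k : ℕ => (k : ℝ)) Nat.cast_injective (P := graded p q)
    (fun k x hx => mem_graded.1 hx) hf (mem_iSup_graded f)
  refine SetLike.le_def.1 (iSup_le fun k => ?_) h1
  rintro g ⟨hgN, hg⟩
  have h2 := mem_iSup_inf (T := casimirOn Finset.univ) (N := N)
    (fun x hx => casimirOn_mem (fun j _ k _ => hN.rotOp_mem j k) hx)
    (μ := fun x : {x : ℕ × ℕ // x.1 < r ∧ 2 * x.1 + x.2 = k} => -((x.1.2 : ℝ) *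
      (x.1.2 + (((Finset.univ : Finset (Idx p q)).card : ℝ) - 2))))
    -- The eigenvalue determines m, and the fixed degree 2i + m = k then determines i.
    (fun x y hxy => by
      have h3 := casimir_eigenvalue_injective (two_le_card hn) hxy
      have h4 := x.2.2
      have h5 := y.2.2
      exact Subtype.ext (Prod.ext (by omega) h3))
    (fun x _ hy => casimirOn_layer hy) hgN
    (mem_iSup_layer hg (mem_higherHarmonics_iff.1 (hle hgN)))
  refine SetLike.le_def.1 (iSup_le fun x => ?_) h2
  exact le_iSup (fun x : {x : ℕ × ℕ // x.1 < r} => N ⊓ layer p q x.1.1 x.1.2) ⟨x.1, x.2.1⟩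

/-- A stable space that is not contained in `N'` contains a layer that is not contained in `N'`. -/
theorem exists_layer_le (hN : IsConfStable r N) (hn : 3 ≤ p + q)
    (hle : N ≤ higherHarmonics p q r) {N' : Submodule ℝ (Poly p q)} (h : ¬N ≤ N') :
    ∃ i m, i < r ∧ layer p q i m ≤ N ∧ ¬layer p q i m ≤ N' := by
  by_contra! h1
  refine h ((hN.le_iSup_layer hn hle).trans (iSup_le fun x => ?_))
  rintro f ⟨hfN, hf⟩
  by_cases h0 : f = 0
  · rw [h0]
    exact zero_mem _
  · exact h1 x.1.1 x.1.2 x.2 (layer_le_of_mem hn hN.rotOp_mem hf hfN h0) hf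

theorem layer_up (hN : IsConfStable r N) (hn : 3 ≤ p + q) {i m : ℕ}
    (h : layer p q i m ≤ N) (hc : (i : ℝ) + m + wt p q r ≠ 0) : layer p q i (m + 1) ≤ N := by
  obtain ⟨f, hf, h0⟩ := harmonics_ne_bot hn m
  obtain ⟨j, hj⟩ := exists_raise_ne_zero hn hf h0
  have h1 := hN.qOp_mem j _ (h (mem_layer.2 ⟨f, hf, rfl⟩))
  rw [qOp_quadForm_pow_mul hn r i j hf] at h1
  have hr : quadForm p q ^ i * raise m j f ∈ layer p q i (m + 1) :=
    mem_layer.2 ⟨_, raise_mem_harmonics hn j hf, rfl⟩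
  -- For m = 0 the truncated m - 1 is 0; this is harmless, because the second component is then
  -- zero.
  have h2 := (mem_of_add_mem hn hN.rotOp_mem (by omega : m + 1 ≠ m - 1) (Submodule.smul_mem _ _ hr)
    (Submodule.smul_mem _ _ (mem_layer.2 ⟨_, pderiv_mem_harmonics j hf, rfl⟩)) h1).1
  have hs : sgn j ≠ 0 := left_ne_zero_of_mul_eq_one (sgn_mul_self j)
  refine layer_le_of_mem hn hN.rotOp_mem hr ((N.smul_mem_iff ?_).1 h2)
    (mul_ne_zero (pow_ne_zero i (quadForm_ne_zero (by omega))) hj)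
  exact mul_ne_zero (mul_ne_zero (by norm_num) hs) hc

theorem layer_succ_left (hN : IsConfStable r N) (hn : 3 ≤ p + q) {i m : ℕ}
    (h : layer p q i (m + 1) ≤ N) (hi : i + 1 < r) : layer p q (i + 1) m ≤ N := by
  obtain ⟨f, hf, h0⟩ := harmonics_ne_bot hn (m + 1)
  obtain ⟨j, hj⟩ := exists_pderiv_ne_zero hf h0
  have h1 := hN.qOp_mem j _ (h (mem_layer.2 ⟨f, hf, rfl⟩))
  rw [qOp_quadForm_pow_mul hn r i j hf] at h1
  have hr : quadForm p q ^ (i + 1) * pderiv j f ∈ layer p q (i + 1) m :=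
    mem_layer.2 ⟨_, pderiv_mem_harmonics_succ j hf, rfl⟩
  have h2 := (mem_of_add_mem hn hN.rotOp_mem (by omega : m + 1 + 1 ≠ m) (Submodule.smul_mem _ _
    (mem_layer.2 ⟨_, raise_mem_harmonics hn j hf, rfl⟩)) (Submodule.smul_mem _ _ hr) h1).2
  refine layer_le_of_mem hn hN.rotOp_mem hr ((N.smul_mem_iff ?_).1 h2)
    (mul_ne_zero (pow_ne_zero _ (quadForm_ne_zero (by omega))) hj)
  have : ((i + 1 : ℕ) : ℝ) < r := by exact_mod_cast hi
  push_cast at this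
  exact mul_ne_zero (mul_ne_zero (by norm_num) (by linarith)) (raiseCoeff_pos hn _).ne'

theorem layer_succ_right (hN : IsConfStable r N) (hn : 3 ≤ p + q) {i m : ℕ}
    (h : layer p q (i + 1) m ≤ N) : layer p q i (m + 1) ≤ N := by
  obtain ⟨f, hf, h0⟩ := harmonics_ne_bot hn m
  obtain ⟨j, hj⟩ := exists_raise_ne_zero hn hf h0
  have h1 := hN.pderiv_mem j _ (h (mem_layer.2 ⟨f, hf, rfl⟩))
  rw [pderiv_quadForm_pow_succ_mul i m] at h1
  have hr : quadForm p q ^ i * raise m j f ∈ layer p q i (m + 1) :=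
    mem_layer.2 ⟨_, raise_mem_harmonics hn j hf, rfl⟩
  have h2 := (mem_of_add_mem hn hN.rotOp_mem (by omega : m + 1 ≠ m - 1) (Submodule.smul_mem _ _ hr)
    (Submodule.smul_mem _ _ (mem_layer.2 ⟨_, pderiv_mem_harmonics j hf, rfl⟩)) h1).1
  have hs : sgn j ≠ 0 := left_ne_zero_of_mul_eq_one (sgn_mul_self j)
  refine layer_le_of_mem hn hN.rotOp_mem hr ((N.smul_mem_iff ?_).1 h2)
    (mul_ne_zero (pow_ne_zero i (quadForm_ne_zero (by omega))) hj)
  exact mul_ne_zero (by positivity) hs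

theorem layer_zero_down (hN : IsConfStable r N) (hn : 3 ≤ p + q) {m : ℕ}
    (h : layer p q 0 (m + 1) ≤ N) : layer p q 0 m ≤ N := by
  obtain ⟨f, hf, h0⟩ := harmonics_ne_bot hn (m + 1)
  obtain ⟨j, hj⟩ := exists_pderiv_ne_zero hf h0
  exact layer_le_of_mem hn hN.rotOp_mem
    (mem_layer.2 ⟨_, pderiv_mem_harmonics_succ j hf, by rw [pow_zero, one_mul]⟩)
    (hN.pderiv_mem j f (h (mem_layer.2 ⟨f, hf, by rw [pow_zero, one_mul]⟩))) hj

/-- The derivatives trade a factor F for one degree of the harmonic, at constant i + m, until i = 0;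
then they lower the degree of the harmonic. No coefficient on this path can vanish. -/
theorem layer_zero_le (hN : IsConfStable r N) (hn : 3 ≤ p + q) {i m : ℕ}
    (h : layer p q i m ≤ N) {k : ℕ} (hk : k ≤ i + m) : layer p q 0 k ≤ N := by
  have h1 : layer p q 0 (i + m) ≤ N := by
    induction i generalizing m with
    | zero => rwa [zero_add]
    | succ i ih =>
      rw [show i + 1 + m = i + (m + 1) by ring]
      exact ih (hN.layer_succ_right hn h) (by omega)
  induction hk using Nat.decreasingInduction with
  | self => exact h1
  | of_succ k _ ih => exact hN.layer_zero_down hn ih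

/-- The way back at constant i + m uses Q_j, whose coefficient is nonzero up to the last admissible
i = r - 1. -/
theorem layer_le_of_layer_zero (hN : IsConfStable r N) (hn : 3 ≤ p + q) {i m : ℕ} (hi : i < r)
    (h : layer p q 0 (i + m) ≤ N) : layer p q i m ≤ N := by
  induction i generalizing m with
  | zero => rwa [zero_add] at h
  | succ i ih =>
    refine hN.layer_succ_left hn (ih (by omega) ?_) hi
    rwa [show i + (m + 1) = i + 1 + m by ring]

/-- A stable space that contains all harmonics contains all higher harmonics. -/
theorem higherHarmonics_le (hN : IsConfStable r N) (hn : 3 ≤ p + q)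
    (h : ∀ m, layer p q 0 m ≤ N) : higherHarmonics p q r ≤ N :=
  ((isConfStable_higherHarmonics p q r).le_iSup_layer hn le_rfl).trans <| iSup_le fun x =>
    inf_le_right.trans (hN.layer_le_of_layer_zero hn x.2 (h _))

/-- A stable space that contains a layer above which no weight vanishes is everything. -/
theorem higherHarmonics_le_of_layer_le (hN : IsConfStable r N) (hn : 3 ≤ p + q) {i m : ℕ}
    (h : layer p q i m ≤ N) (hc : ∀ k, i + m ≤ k → (k : ℝ) + wt p q r ≠ 0) :
    higherHarmonics p q r ≤ N := by
  refine hN.higherHarmonics_le hn fun k => ?_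
  rcases le_total k (i + m) with hk | hk
  · exact hN.layer_zero_le hn h hk
  · induction k, hk using Nat.le_induction with
    | base => exact hN.layer_zero_le hn h le_rfl
    | succ k hk ih => exact hN.layer_up hn ih (by simpa using hc k hk)

end IsConfStable

theorem wt_add_eq_zero_iff (k : ℕ) : (k : ℝ) + wt p q r = 0 ↔ 2 * k + (p + q) = 2 * r := by
  rw [wt, ← Nat.cast_inj (R := ℝ)]
  push_cast
  constructor <;> intro h <;> linarith

/-- The sum of the layers of low total weight. -/
def lowLayers (p q r : ℕ) : Submodule ℝ (Poly p q) :=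
  ⨆ x : {x : ℕ × ℕ // 2 * (x.1 + x.2) + (p + q) ≤ 2 * r}, layer p q x.1.1 x.1.2

theorem layer_le_lowLayers {i m : ℕ} (h : 2 * (i + m) + (p + q) ≤ 2 * r) :
    layer p q i m ≤ lowLayers p q r :=
  le_iSup (fun x : {x : ℕ × ℕ // 2 * (x.1 + x.2) + (p + q) ≤ 2 * r} => layer p q x.1.1 x.1.2)
    ⟨(i, m), h⟩

theorem layer_le_higherHarmonics {i m : ℕ} (hi : i < r) :
    layer p q i m ≤ higherHarmonics p q r := by
  intro f hf
  obtain ⟨h, hh, rfl⟩ := mem_layer.1 hf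
  rw [mem_higherHarmonics_iff]
  induction i generalizing r with
  | zero =>
    obtain ⟨r, rfl⟩ := Nat.exists_eq_succ_of_ne_zero hi.ne'
    rw [pow_succ, Module.End.mul_apply, pow_zero, one_mul, (mem_harmonics.1 hh).2, map_zero]
  | succ i ih =>
    obtain ⟨r, rfl⟩ := Nat.exists_eq_succ_of_ne_zero (Nat.ne_of_gt ((Nat.zero_le _).trans_lt hi))
    rw [pow_succ, Module.End.mul_apply, lapOn_quadForm_pow_mul hh, map_smul,
      ih (by omega) (mem_layer.2 ⟨h, hh, rfl⟩), smul_zero]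

theorem lowLayers_le_higherHarmonics (hn : 1 ≤ p + q) :
    lowLayers p q r ≤ higherHarmonics p q r :=
  iSup_le fun x => layer_le_higherHarmonics (by have := x.2; omega)

/-- If `n` is even, the sum of the layers of low total weight is stable. -/
theorem isConfStable_lowLayers (hn : 3 ≤ p + q) (he : Even (p + q)) :
    IsConfStable r (lowLayers p q r) := by
  have key : ∀ T : Module.End ℝ (Poly p q), (∀ i m, 2 * (i + m) + (p + q) ≤ 2 * r →
      ∀ h ∈ harmonics p q m, T (quadForm p q ^ i * h) ∈ lowLayers p q r) →
      ∀ f ∈ lowLayers p q r, T f ∈ lowLayers p q r := by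
    intro T hT
    refine SetLike.le_def.1 (iSup_le (a := (lowLayers p q r).comap T) fun x => ?_)
    intro f hf
    obtain ⟨h, hh, rfl⟩ := mem_layer.1 hf
    exact hT _ _ x.2 h hh
  have hmem : ∀ i m, 2 * (i + m) + (p + q) ≤ 2 * r → ∀ h ∈ harmonics p q m,
      quadForm p q ^ i * h ∈ lowLayers p q r := fun i m him h hh =>
    layer_le_lowLayers him (mem_layer.2 ⟨h, hh, rfl⟩)
  -- The bound is weaker by 2 because the derivative lowers the total weight i + m by one.
  have hd : ∀ i m j, 2 * (i + m) + (p + q) ≤ 2 * r + 2 → ∀ h ∈ harmonics p q m,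
      quadForm p q ^ i * pderiv j h ∈ lowLayers p q r := by
    intro i m j him h hh
    rcases m with _ | m
    · rw [pderiv_eq_zero_of_mem_harmonics_zero j hh, mul_zero]
      exact zero_mem _
    · exact hmem i m (by omega) _ (pderiv_mem_harmonics_succ j hh)
  refine ⟨key _ ?_, fun j => key (dOp j) ?_, fun j => key _ ?_, fun j k => key _ ?_⟩
  · intro i m him h hh
    rw [euler_eq, eulerOn_quadForm_pow_mul hh.1]
    exact Submodule.smul_mem _ _ (hmem i m him h hh)
  · intro i m him h hh
    rw [dOp_apply]
    rcases i with _ | i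
    · rw [pow_zero, one_mul, ← one_mul (pderiv j h), ← pow_zero (quadForm p q)]
      exact hd 0 m j (by omega) h hh
    · rw [pderiv_quadForm_pow_succ_mul i m]
      exact add_mem
        (Submodule.smul_mem _ _ (hmem i (m + 1) (by omega) _ (raise_mem_harmonics hn j hh)))
        (Submodule.smul_mem _ _ (hd (i + 1) m j (by omega) h hh))
  · intro i m him h hh
    rw [qOp_quadForm_pow_mul hn r i j hh]
    refine add_mem ?_ (Submodule.smul_mem _ _ (hd (i + 1) m j (by omega) h hh))
    by_cases h1 : 2 * (i + (m + 1)) + (p + q) ≤ 2 * r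
    · exact Submodule.smul_mem _ _ (hmem i (m + 1) h1 _ (raise_mem_harmonics hn j hh))
    -- Raising would leave the low layers, so parity of n forces 2(i + m) + n = 2r, and the
    -- coefficient of the raising term is zero.
    · obtain ⟨s, hs⟩ := he
      have h2 : ((i + m : ℕ) : ℝ) + wt p q r = 0 := (wt_add_eq_zero_iff _).2 (by omega)
      rw [Nat.cast_add] at h2
      rw [h2, mul_zero, zero_smul]
      exact zero_mem _
  · intro i m him h hh
    rw [rotOp_quadForm_pow_mul]
    exact hmem i m him _ (rotOp_mem_harmonics j k hh)

theorem graded_le_restrictTotalDegree (k : ℕ) :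
    graded p q k ≤ restrictTotalDegree (Idx p q) ℝ k := by
  intro f hf
  rw [mem_restrictTotalDegree]
  refine Finset.sup_le fun α hα => ?_
  have h1 : ∑ j, α j = k := by
    by_contra h
    refine mem_support_iff.1 hα (coeff_eq_zero_of_eulerOn (mem_graded.1 hf) ?_)
    exact_mod_cast h
  rw [Finsupp.sum_fintype _ _ (fun _ => rfl), h1]

theorem finiteDimensional_lowLayers : FiniteDimensional ℝ (lowLayers p q r) := by
  -- The bound is crude: 2i + m ≤ 2(i + m) ≤ 2r already holds on these layers.
  have h1 : lowLayers p q r ≤ restrictTotalDegree (Idx p q) ℝ (4 * r) := by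
    refine iSup_le fun x f hf => ?_
    obtain ⟨h, hh, rfl⟩ := mem_layer.1 hf
    have h2 : quadForm p q ^ x.1.1 * h ∈ graded p q (2 * x.1.1 + x.1.2) := by
      rw [mem_graded, eulerOn_quadForm_pow_mul hh.1]
      push_cast
      rfl
    have h3 := graded_le_restrictTotalDegree _ h2
    rw [mem_restrictTotalDegree] at h3 ⊢
    have := x.2
    omega
  exact Submodule.finiteDimensional_of_le h1

theorem not_finiteDimensional_higherHarmonics (hn : 3 ≤ p + q) (hr : 1 ≤ r) :
    ¬FiniteDimensional ℝ (higherHarmonics p q r) := by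
  intro hfin
  choose h hh h0 using harmonics_ne_bot (p := p) (q := q) hn
  have hmem : ∀ m, h m ∈ higherHarmonics p q r := fun m =>
    layer_le_higherHarmonics hr (mem_layer.2 ⟨h m, hh m, by rw [pow_zero, one_mul]⟩)
  have h1 : LinearIndependent ℝ h :=
    Module.End.eigenvectors_linearIndependent' (eulerOn Finset.univ) (fun m : ℕ => (m : ℝ))
      Nat.cast_injective h fun m => ⟨(hh m).1, h0 m⟩
  have h2 : LinearIndependent ℝ fun m => (⟨h m, hmem m⟩ : higherHarmonics p q r) :=
    LinearIndependent.of_comp (higherHarmonics p q r).subtype h1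
  exact not_finite_iff_infinite.2 inferInstance (h2.finite)

/-- Every nonzero stable space contains the layers of low total weight. -/
theorem IsConfStable.lowLayers_le {N : Submodule ℝ (Poly p q)} (hN : IsConfStable r N)
    (hn : 3 ≤ p + q) (hle : N ≤ higherHarmonics p q r) (h0 : N ≠ ⊥) : lowLayers p q r ≤ N := by
  obtain ⟨i, m, -, him, -⟩ := hN.exists_layer_le hn hle (fun h => h0 (le_bot_iff.1 h))
  refine iSup_le fun x => hN.layer_le_of_layer_zero hn (by have := x.2; omega) ?_
  have h1 : ∀ k, 2 * k + (p + q) ≤ 2 * r → layer p q 0 k ≤ N := by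
    intro k hk
    -- The ascent from weight k to k + 1 is unobstructed as long as k + 1 still satisfies the bound,
    -- because then k lies strictly below the critical weight.
    induction k with
    | zero => exact hN.layer_zero_le hn him (Nat.zero_le _)
    | succ k ih =>
      refine hN.layer_up hn (ih (by omega)) ?_
      rw [Nat.cast_zero, zero_add, Ne, wt_add_eq_zero_iff]
      omega
  exact h1 _ x.2

/-- A layer outside `lowLayers` has total weight beyond the critical one, so the ascent from it
never meets a vanishing coefficient. -/
theorem IsConfStable.eq_higherHarmonics {N : Submodule ℝ (Poly p q)} (hN : IsConfStable r N)
    (hn : 3 ≤ p + q) (hle : N ≤ higherHarmonics p q r) (h : ¬N ≤ lowLayers p q r) :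
    N = higherHarmonics p q r := by
  obtain ⟨i, m, -, him, hlow⟩ := hN.exists_layer_le hn hle h
  refine le_antisymm hle (hN.higherHarmonics_le_of_layer_le hn him fun k hk => ?_)
  rw [Ne, wt_add_eq_zero_iff]
  intro h1
  exact hlow (layer_le_lowLayers (by omega))

theorem lowLayers_ne_bot (hn : 3 ≤ p + q) (h : p + q ≤ 2 * r) : lowLayers p q r ≠ ⊥ := by
  obtain ⟨f, hf, h0⟩ := harmonics_ne_bot hn 0
  exact (Submodule.ne_bot_iff _).2 ⟨f, layer_le_lowLayers (i := 0) (m := 0) (by omega)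
    (mem_layer.2 ⟨f, hf, by rw [pow_zero, one_mul]⟩), h0⟩

end Stable

/-! ### Modules with a smallest nonzero submodule or a largest proper one. -/

section Socle

variable {R L M : Type*} [CommRing R] [LieRing L] [AddCommGroup M] [Module R M]
  [LieRingModule L M]

theorem isIrreducible_of_forall_le {S : LieSubmodule R L M} (h0 : S ≠ ⊥)
    (hS : ∀ N : LieSubmodule R L M, N ≠ ⊥ → S ≤ N) : LieModule.IsIrreducible R L S := by
  have : Nontrivial S := (LieSubmodule.nontrivial_iff_ne_bot R L M).2 h0
  refine LieModule.IsIrreducible.mk fun N hN => ?_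
  have h1 : N.map S.incl ≠ ⊥ := by
    rw [← LieSubmodule.map_bot (f := S.incl)]
    exact fun h => hN (LieSubmodule.map_injective_of_injective S.injective_incl h)
  refine eq_top_iff.2 fun x _ => ?_
  obtain ⟨y, hy, hyx⟩ := (LieSubmodule.mem_map _).1 (hS _ h1 x.2)
  rwa [← S.injective_incl hyx]

/-- A simple submodule N contains the minimal S, and S is then a nonzero submodule of N, so N = S:
the sum has one term only. -/
theorem socle_eq_of_forall_le [LieAlgebra R L] [LieModule R L M] {S : LieSubmodule R L M} (h0 : S ≠ ⊥)
    (hS : ∀ N : LieSubmodule R L M, N ≠ ⊥ → S ≤ N) : socle R L M = S := by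
  refine le_antisymm (sSup_le fun N hN => ?_) (le_sSup (isIrreducible_of_forall_le h0 hS))
  have hN' : LieModule.IsIrreducible R L N := hN
  have hN0 : N ≠ ⊥ := by
    rintro rfl
    exact not_nontrivial (LieSubmodule R L (⊥ : LieSubmodule R L M)) inferInstance
  have h1 : S.comap N.incl ≠ ⊥ := by
    rw [Ne, LieSubmodule.comap_incl_eq_bot, inf_eq_right.2 (hS N hN0)]
    exact h0
  exact LieSubmodule.comap_incl_eq_top.1 ((eq_bot_or_eq_top _).resolve_left h1)

theorem isIrreducible_quotient [LieAlgebra R L] [LieModule R L M] {S : LieSubmodule R L M} (h0 : S ≠ ⊤)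
    (hS : ∀ N : LieSubmodule R L M, ¬N ≤ S → N = ⊤) : LieModule.IsIrreducible R L (M ⧸ S) := by
  have : Nontrivial (M ⧸ S) := Submodule.Quotient.nontrivial_iff.2 fun h =>
    h0 ((LieSubmodule.toSubmodule_eq_top _).1 h)
  refine LieModule.IsIrreducible.mk fun N hN => ?_
  have h1 : N.comap (LieSubmodule.Quotient.mk' S) = ⊤ := by
    refine hS _ fun h => hN ((LieSubmodule.eq_bot_iff N).2 fun x hx => ?_)
    obtain ⟨y, rfl⟩ := LieSubmodule.Quotient.surjective_mk' S x
    exact (LieSubmodule.Quotient.mk_eq_zero _).2 (h (LieSubmodule.mem_comap.2 hx))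
  refine eq_top_iff.2 fun x _ => ?_
  obtain ⟨y, rfl⟩ := LieSubmodule.Quotient.surjective_mk' S x
  exact LieSubmodule.mem_comap.1 (h1 ▸ LieSubmodule.mem_top y)

end Socle

/-! ### Lie submodules as spaces stable under E, ∂_j, Q_j and D_{jk}. -/

section LieSubmodules

variable {p q r : ℕ}

theorem mem_SO_of_skew {A : Matrix (BigIdx p q) (BigIdx p q) ℝ}
    (hA : ∀ a b, bsgn a * A a b = -(bsgn b * A b a)) : A ∈ SO p q := by
  refine (mem_skewAdjointMatricesSubmodule _ A).2 ?_
  change A.transpose * LieAlgebra.Orthogonal.indefiniteDiagonal (Fin (p + 1)) (Fin (q + 1)) ℝ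
      = LieAlgebra.Orthogonal.indefiniteDiagonal (Fin (p + 1)) (Fin (q + 1)) ℝ * (-A)
  ext b a
  simp only [LieAlgebra.Orthogonal.indefiniteDiagonal, Matrix.mul_diagonal, Matrix.diagonal_mul,
    Matrix.transpose_apply, Matrix.neg_apply]
  change A a b * bsgn a = bsgn b * -(A b a)
  linarith [hA a b]

/-- The skew matrix that generates the rotations in the plane of the coordinates `a` and `b`. -/
def skewUnit (a b : BigIdx p q) : Matrix (BigIdx p q) (BigIdx p q) ℝ :=
  Matrix.of fun x y => (if x = a ∧ y = b then 1 else 0)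
    - bsgn a * bsgn b * (if x = b ∧ y = a then 1 else 0)

theorem skewUnit_apply (a b x y : BigIdx p q) :
    skewUnit a b x y = (if x = a ∧ y = b then 1 else 0)
      - bsgn a * bsgn b * (if x = b ∧ y = a then 1 else 0) := rfl

theorem bsgn_mul_self (a : BigIdx p q) : bsgn a * bsgn a = 1 := by
  rcases a with a | a <;> simp [bsgn]

theorem skewUnit_mem (a b : BigIdx p q) : skewUnit a b ∈ SO p q := by
  refine mem_SO_of_skew fun x y => ?_
  rw [skewUnit_apply, skewUnit_apply]
  have ha := bsgn_mul_self a
  have hb := bsgn_mul_self b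
  have e1 : ∀ c d : BigIdx p q, (bsgn x * if x = c ∧ y = d then (1 : ℝ) else 0)
      = bsgn c * if y = d ∧ x = c then 1 else 0 := by
    intro c d
    by_cases h : x = c ∧ y = d
    · rw [if_pos h, if_pos h.symm, h.1]
    · rw [if_neg h, if_neg fun h' => h h'.symm, mul_zero, mul_zero]
  have e2 : ∀ c d : BigIdx p q, (bsgn y * if y = c ∧ x = d then (1 : ℝ) else 0)
      = bsgn c * if y = c ∧ x = d then 1 else 0 := by
    intro c d
    by_cases h : y = c ∧ x = d
    · rw [if_pos h, h.1]
    · rw [if_neg h, mul_zero, mul_zero]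
  have h1 := e1 a b
  have h2 := e1 b a
  have h3 := e2 a b
  have h4 := e2 b a
  linear_combination h1 - bsgn a * bsgn b * h2 + h3 - bsgn a * bsgn b * h4
    - bsgn a * (if y = b ∧ x = a then 1 else 0) * hb
    - bsgn a * (if y = a ∧ x = b then 1 else 0) * hb

theorem up_ne_plus (j : Idx p q) : up j ≠ plus := by
  rcases j with j | j <;> simp [up]

theorem up_ne_minus (j : Idx p q) : up j ≠ minus := by
  rcases j with j | j <;> simp [up]

theorem up_injective : Function.Injective (up : Idx p q → BigIdx p q) :=
  Function.Injective.sumMap (Fin.succ_injective _) (Fin.succ_injective _)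

theorem confOp_apply (A : Matrix (BigIdx p q) (BigIdx p q) ℝ) :
    confOp p q r A = A plus minus • eulerShift p q r
    - (1 / 2 : ℝ) • ∑ j, (A (up j) minus + A (up j) plus) • dOp j
    - (1 / 2 : ℝ) • ∑ j, (A (up j) minus - A (up j) plus) • qOp r j
    - (1 / 2 : ℝ) • ∑ j, ∑ k, A (up k) (up j) • rotOp j k := rfl

theorem confOp_skewUnit_plus_minus : confOp p q r (skewUnit plus minus) = eulerShift p q r := by
  rw [confOp_apply]
  simp [skewUnit_apply, up_ne_plus, up_ne_minus]

theorem confOp_skewUnit_up_plus (j : Idx p q) :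
    confOp p q r (skewUnit (up j) plus) = (1 / 2 : ℝ) • (qOp r j - dOp j) := by
  have h1 : ∀ i : Idx p q, (skewUnit (up j) plus (up i) minus - skewUnit (up j) plus (up i) plus)
      • qOp r i = if i = j then -qOp r j else 0 := by
    intro i
    by_cases h : i = j
    · subst h
      have h2 : skewUnit (up i) plus (up i) minus - skewUnit (up i) plus (up i) plus = -1 := by
        simp [skewUnit_apply, up_ne_plus]
      rw [h2, if_pos rfl]
      module
    · simp [skewUnit_apply, up_ne_plus, up_injective.eq_iff, h]
  rw [confOp_apply, Finset.sum_congr rfl fun i _ => h1 i, Finset.sum_ite_eq']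
  simp [skewUnit_apply, up_ne_plus, (up_ne_plus _).symm, (up_ne_minus _).symm,
    up_injective.eq_iff, -Fintype.sum_sum_type]
  module

theorem confOp_skewUnit_up_minus (j : Idx p q) :
    confOp p q r (skewUnit (up j) minus) = -(1 / 2 : ℝ) • (qOp r j + dOp j) := by
  rw [confOp_apply]
  simp [skewUnit_apply, up_ne_minus, (up_ne_plus _).symm, (up_ne_minus _).symm, up_injective.eq_iff,
    ite_smul, neg_smul, -Fintype.sum_sum_type]
  module

theorem rotOp_swap (j k : Idx p q) : rotOp k j = -(sgn j * sgn k) • rotOp j k := by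
  have h : (sgn j * sgn k) * (sgn j * sgn k) = 1 := by
    linear_combination sgn_mul_self j * sgn k * sgn k + sgn_mul_self k
  rw [rotOp, rotOp, smul_sub, smul_smul, mul_comm (sgn k), neg_mul, h]
  module

theorem confOp_skewUnit_up_up (j k : Idx p q) :
    confOp p q r (skewUnit (up k) (up j)) = -rotOp j k := by
  have h0 : ∀ (s t : ℝ) (T : Module.End ℝ (Poly p q)), (s - t) • T = s • T - t • T :=
    fun s t T => sub_smul s t T
  -- The entry at (k, j) and its skew partner contribute the same rotation, by `rotOp_swap`; the two
  -- copies cancel the factor 1/2.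
  have h1 : ∀ a b : Idx p q, skewUnit (up k) (up j) (up b) (up a) • rotOp a b
      = (if a = j then (if b = k then rotOp j k else 0) else 0)
        + (if a = k then (if b = j then rotOp j k else 0) else 0) := by
    intro a b
    rw [skewUnit_apply, bsgn_up, bsgn_up]
    rw [h0, sub_eq_add_neg]
    simp only [up_injective.eq_iff]
    congr 1
    · by_cases ha : a = j <;> by_cases hb : b = k <;> simp [ha, hb]
    · by_cases ha : a = k <;> by_cases hb : b = j <;> simp [ha, hb]
      rw [rotOp_swap j k, smul_smul]
      have h : (sgn k * sgn j) * (sgn j * sgn k) = 1 := by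
        linear_combination sgn_mul_self j * sgn k * sgn k + sgn_mul_self k
      rw [mul_neg, h]
      module
  rw [confOp_apply]
  simp only [h1, Finset.sum_add_distrib, Finset.sum_ite_eq', Finset.sum_ite_irrel,
    Finset.sum_const_zero, Finset.mem_univ, if_true]
  simp [skewUnit_apply, (up_ne_plus _).symm, (up_ne_minus _).symm]
  module

theorem coe_lie (A : SO p q) (f : higherHarmonics p q r) :
    ((⁅A, f⁆ : higherHarmonics p q r) : Poly p q)
      = confOp p q r (A : Matrix (BigIdx p q) (BigIdx p q) ℝ) f := rfl

/-- The underlying space of polynomials of a submodule of the higher harmonics. -/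
def polys (N : LieSubmodule ℝ (SO p q) (higherHarmonics p q r)) : Submodule ℝ (Poly p q) :=
  N.toSubmodule.map (higherHarmonics p q r).subtype

theorem coe_mem_polys {N : LieSubmodule ℝ (SO p q) (higherHarmonics p q r)}
    {f : higherHarmonics p q r} : (f : Poly p q) ∈ polys N ↔ f ∈ N := by
  constructor
  · rintro ⟨g, hg, hgf⟩
    rwa [← Subtype.ext hgf]
  · intro hf
    exact ⟨f, hf, rfl⟩

theorem polys_le_higherHarmonics (N : LieSubmodule ℝ (SO p q) (higherHarmonics p q r)) :
    polys N ≤ higherHarmonics p q r := by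
  rintro _ ⟨f, -, rfl⟩
  exact f.2

theorem polys_ne_bot {N : LieSubmodule ℝ (SO p q) (higherHarmonics p q r)} (hN : N ≠ ⊥) :
    polys N ≠ ⊥ := by
  intro h
  refine hN ((LieSubmodule.eq_bot_iff N).2 fun f hf => Subtype.ext ?_)
  have h1 := coe_mem_polys.2 hf
  rwa [h, Submodule.mem_bot] at h1

/-- The elementary skew matrices act, up to nonzero scalars, by E + d, Q_j - ∂_j, Q_j + ∂_j and
D_{jk}; sums and differences isolate the individual operators. -/
theorem isConfStable_polys (N : LieSubmodule ℝ (SO p q) (higherHarmonics p q r)) :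
    IsConfStable r (polys N) := by
  have h1 : ∀ A ∈ SO p q, ∀ f ∈ polys N, confOp p q r A f ∈ polys N := by
    rintro A hA _ ⟨f, hf, rfl⟩
    exact ⟨⁅(⟨A, hA⟩ : SO p q), f⁆, N.lie_mem hf, coe_lie _ _⟩
  have hpl : ∀ j, ∀ f ∈ polys N, qOp r j f - dOp j f ∈ polys N := by
    intro j f hf
    have h := h1 _ (skewUnit_mem (up j) plus) f hf
    rw [confOp_skewUnit_up_plus, LinearMap.smul_apply] at h
    exact ((polys N).smul_mem_iff (by norm_num)).1 h
  have hmi : ∀ j, ∀ f ∈ polys N, qOp r j f + dOp j f ∈ polys N := by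
    intro j f hf
    have h := h1 _ (skewUnit_mem (up j) minus) f hf
    rw [confOp_skewUnit_up_minus, LinearMap.smul_apply] at h
    exact ((polys N).smul_mem_iff (by norm_num)).1 h
  refine ⟨fun f hf => ?_, fun j f hf => ?_, fun j f hf => ?_, fun j k f hf => ?_⟩
  · have h := h1 _ (skewUnit_mem plus minus) f hf
    rw [confOp_skewUnit_plus_minus, eulerShift_apply, ← smul_eq_C_mul] at h
    exact ((polys N).add_mem_iff_left ((polys N).smul_mem _ hf)).1 h
  · have h := (polys N).smul_mem (1 / 2 : ℝ) ((polys N).sub_mem (hmi j f hf) (hpl j f hf))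
    convert h using 1
    rw [← dOp_apply]
    module
  · have h := (polys N).smul_mem (1 / 2 : ℝ) ((polys N).add_mem (hmi j f hf) (hpl j f hf))
    convert h using 1
    module
  · have h := h1 _ (skewUnit_mem (up k) (up j)) f hf
    rw [confOp_skewUnit_up_up, LinearMap.neg_apply] at h
    exact (polys N).neg_mem_iff.1 h

/-- The submodule of the higher harmonics given by a stable space of polynomials. -/
def IsConfStable.toLieSubmodule {N : Submodule ℝ (Poly p q)} (hN : IsConfStable r N) :
    LieSubmodule ℝ (SO p q) (higherHarmonics p q r) where
  __ := N.comap (higherHarmonics p q r).subtype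
  lie_mem := by
    intro A f hf
    change confOp p q r (A : Matrix (BigIdx p q) (BigIdx p q) ℝ) (f : Poly p q) ∈ N
    have hf' : (f : Poly p q) ∈ N := hf
    simp only [confOp_apply, LinearMap.sub_apply, LinearMap.smul_apply, LinearMap.sum_apply]
    refine sub_mem (sub_mem (sub_mem (N.smul_mem _ ?_) ?_) ?_) ?_
    · rw [eulerShift_apply, ← smul_eq_C_mul]
      exact add_mem (hN.euler_mem _ hf') (N.smul_mem _ hf')
    · exact N.smul_mem _ (sum_mem fun j _ => N.smul_mem _ (hN.pderiv_mem j _ hf'))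
    · exact N.smul_mem _ (sum_mem fun j _ => N.smul_mem _ (hN.qOp_mem j _ hf'))
    · exact N.smul_mem _ (sum_mem fun j _ => sum_mem fun k _ =>
        N.smul_mem _ (hN.rotOp_mem j k _ hf'))

theorem eq_top_of_polys_eq {N : LieSubmodule ℝ (SO p q) (higherHarmonics p q r)}
    (h : higherHarmonics p q r ≤ polys N) : N = ⊤ :=
  eq_top_iff.2 fun f _ => coe_mem_polys.1 (h f.2)

theorem isIrreducible_higherHarmonics (hn : 3 ≤ p + q) (hr : 1 ≤ r)
    (hwt : ∀ k : ℕ, 2 * k + (p + q) ≠ 2 * r) :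
    LieModule.IsIrreducible ℝ (SO p q) (higherHarmonics p q r) := by
  have : Nontrivial (higherHarmonics p q r) := by
    obtain ⟨f, hf, h0⟩ := harmonics_ne_bot hn 0
    exact Submodule.nontrivial_iff_ne_bot.2 ((Submodule.ne_bot_iff _).2
      ⟨f, layer_le_higherHarmonics hr (mem_layer.2 ⟨f, hf, by rw [pow_zero, one_mul]⟩), h0⟩)
  refine LieModule.IsIrreducible.mk fun N hN => eq_top_of_polys_eq ?_
  have hst := isConfStable_polys N
  obtain ⟨i, m, -, him, -⟩ := hst.exists_layer_le hn (polys_le_higherHarmonics N)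
    (fun h => polys_ne_bot hN (le_bot_iff.1 h))
  exact hst.higherHarmonics_le_of_layer_le hn him fun k _ => mt (wt_add_eq_zero_iff k).1 (hwt k)

end LieSubmodules

end

end HigherHarmonics

/-! ### The theorem: the socle is the submodule of low layers. -/

open HigherHarmonics in
theorem corollary9p8 (p q r : ℕ) (hp : 1 ≤ p) (hn : 3 ≤ p + q) (hr : 1 ≤ r) :
    (Odd (p + q) ∨ (Even (p + q) ∧ 2 * r < p + q) →
      LieModule.IsIrreducible ℝ (SO p q) (higherHarmonics p q r)) ∧
    (Even (p + q) ∧ p + q ≤ 2 * r →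
      LieModule.IsIrreducible ℝ (SO p q) (socle ℝ (SO p q) (higherHarmonics p q r)) ∧
      FiniteDimensional ℝ (socle ℝ (SO p q) (higherHarmonics p q r)) ∧
      LieModule.IsIrreducible ℝ (SO p q)
        (higherHarmonics p q r ⧸ socle ℝ (SO p q) (higherHarmonics p q r)) ∧
      ¬ FiniteDimensional ℝ
        (higherHarmonics p q r ⧸ socle ℝ (SO p q) (higherHarmonics p q r))) := by
  refine ⟨fun h => isIrreducible_higherHarmonics hn hr fun k hk => ?_, fun ⟨he, hle⟩ => ?_⟩
  -- A critical weight k would need 2k + n = 2r, which is excluded by parity for odd n and by size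
  -- for 2r < n.
  · rcases h with ⟨s, hs⟩ | ⟨-, h⟩ <;> omega
  have hlow := isConfStable_lowLayers (r := r) hn he
  have hS : ∀ N : LieSubmodule ℝ (SO p q) (higherHarmonics p q r), N ≠ ⊥ →
      hlow.toLieSubmodule ≤ N := fun N hN f hf => coe_mem_polys.1
    ((isConfStable_polys N).lowLayers_le hn (polys_le_higherHarmonics N) (polys_ne_bot hN) hf)
  have hS0 : hlow.toLieSubmodule ≠ ⊥ := by
    obtain ⟨f, hf, h0⟩ := (Submodule.ne_bot_iff _).1 (lowLayers_ne_bot hn hle)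
    intro h
    have h1 : (⟨f, lowLayers_le_higherHarmonics (by omega) hf⟩ : higherHarmonics p q r)
        ∈ hlow.toLieSubmodule := hf
    rw [h, LieSubmodule.mem_bot] at h1
    exact h0 (congrArg Subtype.val h1)
  have hfin : FiniteDimensional ℝ hlow.toLieSubmodule := by
    have := finiteDimensional_lowLayers (p := p) (q := q) (r := r)
    exact FiniteDimensional.of_injective (V₂ := lowLayers p q r)
      (((higherHarmonics p q r).subtype ∘ₗ hlow.toLieSubmodule.toSubmodule.subtype).codRestrict
        (lowLayers p q r) fun f => f.2) fun f g hfg =>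
          Subtype.ext (Subtype.ext (Subtype.ext_iff.1 hfg :))
  -- Since the low layers are finite-dimensional, a finite-dimensional quotient would make the whole
  -- space of higher harmonics finite-dimensional.
  have hinf : ¬ FiniteDimensional ℝ (higherHarmonics p q r ⧸ hlow.toLieSubmodule) := by
    intro h
    have h1 : FiniteDimensional ℝ
        (higherHarmonics p q r ⧸ hlow.toLieSubmodule.toSubmodule) := h
    have h2 : FiniteDimensional ℝ hlow.toLieSubmodule.toSubmodule := hfin
    exact not_finiteDimensional_higherHarmonics hn hr
      (Module.Finite.of_submodule_quotient hlow.toLieSubmodule.toSubmodule)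
  rw [socle_eq_of_forall_le hS0 hS]
  refine ⟨isIrreducible_of_forall_le hS0 hS, hfin, isIrreducible_quotient ?_ ?_, hinf⟩
  · intro h
    refine hinf ?_
    have h1 : hlow.toLieSubmodule.toSubmodule = ⊤ := (LieSubmodule.toSubmodule_eq_top _).2 h
    have h2 : Subsingleton (higherHarmonics p q r ⧸ hlow.toLieSubmodule) :=
      Submodule.Quotient.subsingleton_iff.2 h1
    infer_instance
  · intro N hN
    refine eq_top_of_polys_eq ((isConfStable_polys N).eq_higherHarmonics hn
      (polys_le_higherHarmonics N) fun h => hN fun f hf => h (coe_mem_polys.2 hf)).ge
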